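/- **Theorem.** Let $d_1,d_2>0$, $\Omega=\mathbb R\times(-d_2,d_1)$, and let $m$ be the length measure on the barrier $\mathbb R\times\{0\}\subset\Omega$, i.e. $\int f\,dm=\int_{\mathbb R}f(x,0)\,dx$. Let $\alpha_0\in\mathbb R$ and let $\alpha:\mathbb R\to\mathbb R$ be Borel measurable, such that for some $a\in(0,1)$ and $b>0$ $$\int|\psi|^2\,(1+\alpha(x)^2)\,dm\le a\int_\Omega|\nabla\psi|^2+b\int_\Omega|\psi|^2\qquad\text{for all }\psi\in C_0^\infty(\Omega).$$ Let $I_m:W_0^{1,2}(\Omega)\to L^2(m)$ be the unique bounded operator with $I_m\varphi=\varphi|_{\mathbb R\times\{0\}}$ for $\varphi\in C_0^\infty(\Omega)$. For $\beta=\alpha$ and for the constant function $\beta=\alpha_0$ let $H_{\beta m}=-\Delta_D^\Omega+\beta(x)\delta(y)$ be the self-adjoint operator in $L^2(\Omega)$ associated with the form $$\mathcal E_{\beta m}(\psi,\varphi)=\int_\Omega\overline{\nabla\psi}\cdot\nabla\varphi+\int\beta\,\overline{I_m\psi}\,I_m\varphi\,dm,\qquad D(\mathcal E_{\beta m})=W_0^{1,2}(\Omega),$$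 and, where they exist, put $$R^k(\beta)=(H_{\beta m}-k^2)^{-1},\quad R^k_{dx,m}(\beta)=I_mR^k(\beta),\quad R^k_{m,dx}(\beta)=\bigl(R^{\bar k}_{dx,m}(\beta)\bigr)^*,\quad R^k_{m,m}(\beta)=I_mR^k_{m,dx}(\beta).$$ Functions of $x$ also denote the operators of multiplication by them in $L^2(m)$ (on their maximal domains), $(\alpha-\alpha_0)^{1/2}:=|\alpha-\alpha_0|^{1/2}\operatorname{sgn}(\alpha-\alpha_0)$, and products of operators are taken on their natural domains. Let $k\in\mathbb C^+_{\Omega,\alpha_0}:=\{k\in\mathbb C:\ \operatorname{Im}k>0\ \text{or}\ k^2\in[0,\inf\sigma(H_{\alpha_0m}))\}$; if $k$ is purely imaginary, assume in addition that $k^2\in\rho(H_{\alpha_0m})$. Then $k^2\in\rho(H_{\alpha m})$ if and only if the operator $$I+|\alpha-\alpha_0|^{1/2}R^k_{m,m}(\alpha_0)(\alpha-\alpha_0)^{1/2}$$ in $L^2(m)$ is injective with a densely defined bounded inverse, and in that case $$R^k(\alpha)=R^k(\alpha_0)-R^k_{m,dx}(\alpha_0)(\alpha-\alpha_0)^{1/2}\Bigl[I+|\alpha-\alpha_0|^{1/2}R^k_{m,m}(\alpha_0)(\alpha-\alpha_0)^{1/2}\Bigr]^{-1}|\alpha-\alpha_0|^{1/2}R^k_{dx,m}(\alpha_0);$$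 in particular, the product on the right is defined on all of $L^2(\Omega)$. -/

import Mathlib

open MeasureTheory
open scoped ContDiff InnerProductSpace

noncomputable section

namespace Waveguide

/-! ### Partially defined linear operators -/

section Operators

variable {E F G : Type*} [NormedAddCommGroup E] [NormedSpace ℂ E] [NormedAddCommGroup F]
  [NormedSpace ℂ F] [NormedAddCommGroup G] [NormedSpace ℂ G]

/-- The product `g ∘ f` of two partially defined operators, on its natural domain
`{x ∈ D(f) : f x ∈ D(g)}`. -/
def pcomp (g : F →ₗ.[ℂ] G) (f : E →ₗ.[ℂ] F) : E →ₗ.[ℂ] G :=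
  g.comp (f.domRestrict ((g.domain.comap f.toFun).map f.domain.subtype)) (by
    rintro ⟨x, hx⟩
    obtain ⟨⟨⟨x', hx'⟩, hg, rfl⟩, hf⟩ := hx
    exact hg)

/-- The identity operator, everywhere defined. -/
def pid (E : Type*) [NormedAddCommGroup E] [NormedSpace ℂ E] : E →ₗ.[ℂ] E :=
  (LinearMap.id : E →ₗ[ℂ] E).toPMap ⊤

/-- `T` is injective with a densely defined bounded inverse. -/
def HasBoundedInverse (T : E →ₗ.[ℂ] F) : Prop :=
  (∃ C : ℝ, ∀ x : T.domain, ‖(x : E)‖ ≤ C * ‖T x‖) ∧ Dense (Set.range T)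

/-- The resolvent set of `T`: those `z` for which `T - z` maps `D(T)` bijectively onto the space
and has a bounded inverse. -/
def resolventSet (T : E →ₗ.[ℂ] E) : Set ℂ :=
  {z | (∃ C : ℝ, ∀ x : (T - z • pid E).domain, ‖(x : E)‖ ≤ C * ‖(T - z • pid E) x‖) ∧
    Set.range (T - z • pid E) = Set.univ}

/-- `inf σ(T)`, the infimum of the (real) spectrum of a self-adjoint operator. -/
def infSpectrum (T : E →ₗ.[ℂ] E) : EReal :=
  sInf ((fun s : ℝ => (s : EReal)) '' {s : ℝ | (s : ℂ) ∉ resolventSet T})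

/-- The resolvent `(T - z)⁻¹`. -/
def resolvent (T : E →ₗ.[ℂ] E) (z : ℂ) : E →ₗ.[ℂ] E :=
  (T - z • pid E).inverse

end Operators

/-! ### The strip, the barrier measure and the form domain -/

/-- The double strip `Ω = ℝ × (-d₂, d₁)`. -/
def strip (d₁ d₂ : ℝ) : Set (ℝ × ℝ) := {p | -d₂ < p.2 ∧ p.2 < d₁}

/-- Lebesgue measure on `Ω`. -/
def stripMeasure (d₁ d₂ : ℝ) : Measure (ℝ × ℝ) :=
  (volume : Measure (ℝ × ℝ)).restrict (strip d₁ d₂)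

/-- The measure `m = dx ⊗ δ(y)`: the arc length of the barrier `ℝ × {0}`. -/
def barrier : Measure (ℝ × ℝ) := (volume : Measure ℝ).map (fun x => (x, (0 : ℝ)))

/-- `L²(Ω)`. -/
abbrev L2Strip (d₁ d₂ : ℝ) : Type := Lp ℂ 2 (stripMeasure d₁ d₂)

/-- `L²(m)`. -/
abbrev L2Barrier : Type := Lp ℂ 2 barrier

/-- `φ ∈ C₀^∞(Ω)`. -/
def IsTest (d₁ d₂ : ℝ) (φ : ℝ × ℝ → ℂ) : Prop :=
  ContDiff ℝ ∞ φ ∧ HasCompactSupport φ ∧ tsupport φ ⊆ strip d₁ d₂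

/-- The partial derivative `∂φ/∂x`. -/
def dX (φ : ℝ × ℝ → ℂ) (p : ℝ × ℝ) : ℂ := fderiv ℝ φ p (1, 0)

/-- The partial derivative `∂φ/∂y`. -/
def dY (φ : ℝ × ℝ → ℂ) (p : ℝ × ℝ) : ℂ := fderiv ℝ φ p (0, 1)

/-- The triple `U = (u, (v, w))` in `L²(Ω)³` is `(φ, (∂φ/∂x, ∂φ/∂y))`. -/
def Represents (d₁ d₂ : ℝ) (φ : ℝ × ℝ → ℂ)
    (U : L2Strip d₁ d₂ × (L2Strip d₁ d₂ × L2Strip d₁ d₂)) : Prop :=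
  U.1 =ᵐ[stripMeasure d₁ d₂] φ ∧ U.2.1 =ᵐ[stripMeasure d₁ d₂] dX φ ∧
    U.2.2 =ᵐ[stripMeasure d₁ d₂] dY φ

lemma IsTest.zero (d₁ d₂ : ℝ) : IsTest d₁ d₂ 0 := by
  refine ⟨contDiff_const, HasCompactSupport.zero, ?_⟩
  simp [tsupport]

lemma IsTest.add {d₁ d₂ : ℝ} {φ ψ : ℝ × ℝ → ℂ} (hφ : IsTest d₁ d₂ φ) (hψ : IsTest d₁ d₂ ψ) :
    IsTest d₁ d₂ (φ + ψ) :=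
  ⟨hφ.1.add hψ.1, hφ.2.1.add hψ.2.1,
    (tsupport_add φ ψ).trans (Set.union_subset hφ.2.2 hψ.2.2)⟩

lemma IsTest.smul {d₁ d₂ : ℝ} {φ : ℝ × ℝ → ℂ} (c : ℂ) (hφ : IsTest d₁ d₂ φ) :
    IsTest d₁ d₂ (c • φ) :=
  ⟨contDiff_const.smul hφ.1, hφ.2.1.smul_left (f := fun _ => c),
    (tsupport_smul_subset_right (fun _ => c) φ).trans hφ.2.2⟩

/-- The copy `{(φ, ∇φ) : φ ∈ C₀^∞(Ω)}` of the space of test functions in `L²(Ω)³`. -/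
def testGraph (d₁ d₂ : ℝ) : Submodule ℂ (L2Strip d₁ d₂ × (L2Strip d₁ d₂ × L2Strip d₁ d₂)) where
  carrier := {U | ∃ φ, IsTest d₁ d₂ φ ∧ Represents d₁ d₂ φ U}
  zero_mem' := by
    refine ⟨0, IsTest.zero d₁ d₂, ?_, ?_, ?_⟩
    · exact Lp.coeFn_zero _ _ _
    · filter_upwards [Lp.coeFn_zero ℂ 2 (stripMeasure d₁ d₂)] with p hp
      simpa [dX] using hp
    · filter_upwards [Lp.coeFn_zero ℂ 2 (stripMeasure d₁ d₂)] with p hp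
      simpa [dY] using hp
  add_mem' := by
    rintro U V ⟨φ, hφ, h1, h2, h3⟩ ⟨ψ, hψ, k1, k2, k3⟩
    have hd : ∀ p, fderiv ℝ (φ + ψ) p = fderiv ℝ φ p + fderiv ℝ ψ p := fun p =>
      fderiv_add ((hφ.1.differentiable (by simp)) p) ((hψ.1.differentiable (by simp)) p)
    refine ⟨φ + ψ, hφ.add hψ, ?_, ?_, ?_⟩
    · filter_upwards [Lp.coeFn_add U.1 V.1, h1, k1] with p hp a b
      change (U.1 + V.1 : L2Strip d₁ d₂) p = _
      rw [hp, Pi.add_apply, Pi.add_apply, a, b]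
    · filter_upwards [Lp.coeFn_add U.2.1 V.2.1, h2, k2] with p hp a b
      change (U.2.1 + V.2.1 : L2Strip d₁ d₂) p = _
      rw [hp, Pi.add_apply, a, b]
      simp [dX, hd]
    · filter_upwards [Lp.coeFn_add U.2.2 V.2.2, h3, k3] with p hp a b
      change (U.2.2 + V.2.2 : L2Strip d₁ d₂) p = _
      rw [hp, Pi.add_apply, a, b]
      simp [dY, hd]
  smul_mem' := by
    rintro c U ⟨φ, hφ, h1, h2, h3⟩
    have hd : ∀ p, fderiv ℝ (c • φ) p = c • fderiv ℝ φ p := fun p =>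
      fderiv_const_smul ((hφ.1.differentiable (by simp)) p) c
    refine ⟨c • φ, hφ.smul c, ?_, ?_, ?_⟩
    · filter_upwards [Lp.coeFn_smul c U.1, h1] with p hp a
      simp [hp, a]
    · filter_upwards [Lp.coeFn_smul c U.2.1, h2] with p hp a
      simp [hp, a, dX, hd]
    · filter_upwards [Lp.coeFn_smul c U.2.2, h3] with p hp a
      simp [hp, a, dY, hd]

/-- The Sobolev space `W₀^{1,2}(Ω)`, the closure of `C₀^∞(Ω)` in the `W^{1,2}` norm. An element is
recorded as the pair `U = (u, ∇u)` in `L²(Ω) × L²(Ω)²`; it is determined by `u`. -/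
abbrev W (d₁ d₂ : ℝ) : Type := ↥((testGraph d₁ d₂).topologicalClosure)

/-- The embedding `W₀^{1,2}(Ω) → L²(Ω)`. -/
def W.incl (d₁ d₂ : ℝ) : W d₁ d₂ →ₗ[ℂ] L2Strip d₁ d₂ :=
  (LinearMap.fst ℂ _ _).comp (Submodule.subtype _)

/-- `T : W₀^{1,2}(Ω) → L²(m)` restricts every `φ ∈ C₀^∞(Ω)` to the barrier. -/
def IsTrace (d₁ d₂ : ℝ) (T : W d₁ d₂ →L[ℂ] L2Barrier) : Prop :=
  ∀ (U : W d₁ d₂) (φ : ℝ × ℝ → ℂ), IsTest d₁ d₂ φ → Represents d₁ d₂ φ U.1 → T U =ᵐ[barrier] φ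

open Classical in
/-- `I_m`: the unique bounded operator `W₀^{1,2}(Ω) → L²(m)` with `I_m φ = φ` for
`φ ∈ C₀^∞(Ω)`. -/
def trace (d₁ d₂ : ℝ) : W d₁ d₂ →L[ℂ] L2Barrier :=
  if h : ∃ T, IsTrace d₁ d₂ T then h.choose else 0

/-- `I_m` as a partially defined operator `L²(Ω) → L²(m)` with domain `W₀^{1,2}(Ω)`. -/
def tracePMap (d₁ d₂ : ℝ) : L2Strip d₁ d₂ →ₗ.[ℂ] L2Barrier :=
  (LinearMap.range ((W.incl d₁ d₂).prod (trace d₁ d₂ : W d₁ d₂ →ₗ[ℂ] L2Barrier))).toLinearPMap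

/-! ### The Hamiltonian -/

/-- The standing assumption on `α`: for some positive `a < 1` and `b`,
`∫ |ψ|² (1 + α²) dm ≤ a ∫ |∇ψ|² + b ∫ |ψ|²` for all `ψ ∈ C₀^∞(Ω)`. -/
def FormBounded (d₁ d₂ : ℝ) (α : ℝ → ℝ) : Prop :=
  ∃ a b : ℝ, 0 < a ∧ a < 1 ∧ 0 < b ∧ ∀ ψ : ℝ × ℝ → ℂ, IsTest d₁ d₂ ψ →
    ∫⁻ p, ENNReal.ofReal (‖ψ p‖ ^ 2 * (1 + α p.1 ^ 2)) ∂barrier ≤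
      ENNReal.ofReal (a * ∫ p, (‖dX ψ p‖ ^ 2 + ‖dY ψ p‖ ^ 2) ∂stripMeasure d₁ d₂ +
        b * ∫ p, ‖ψ p‖ ^ 2 ∂stripMeasure d₁ d₂)

/-- The integrand `α · conj(I_m U) · I_m V` of the interaction term. -/
def interaction (d₁ d₂ : ℝ) (α : ℝ → ℝ) (U V : W d₁ d₂) (p : ℝ × ℝ) : ℂ :=
  (α p.1 : ℂ) * (starRingEnd ℂ (trace d₁ d₂ U p) * trace d₁ d₂ V p)

/-- The form `E_{αm}(U, V) = ∫ conj(∇U)·∇V dx + ∫ α conj(I_m U) (I_m V) dm` on `W₀^{1,2}(Ω)`,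
antilinear in the first argument. -/
def form (d₁ d₂ : ℝ) (α : ℝ → ℝ) (U V : W d₁ d₂) : ℂ :=
  ⟪U.1.2.1, V.1.2.1⟫_ℂ + ⟪U.1.2.2, V.1.2.2⟫_ℂ + ∫ p, interaction d₁ d₂ α U V p ∂barrier

/-- The graph of the operator associated with the form: `u ∈ D(H)` and `H u = w` iff
`u ∈ W₀^{1,2}(Ω)` and `E_{αm}(u, φ) = (w, φ)` for all `φ ∈ W₀^{1,2}(Ω)`. The integrability
clause holds for all `u`, `φ` if `α` is form bounded. -/
def hamiltonianGraph (d₁ d₂ : ℝ) (α : ℝ → ℝ) :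
    Submodule ℂ (L2Strip d₁ d₂ × L2Strip d₁ d₂) where
  carrier := {q | ∃ U : W d₁ d₂, W.incl d₁ d₂ U = q.1 ∧ ∀ V : W d₁ d₂,
    Integrable (interaction d₁ d₂ α U V) barrier ∧ form d₁ d₂ α U V = ⟪q.2, W.incl d₁ d₂ V⟫_ℂ}
  zero_mem' := by
    refine ⟨0, by simp, fun V => ?_⟩
    have h : interaction d₁ d₂ α 0 V =ᵐ[barrier] 0 := by
      filter_upwards [Lp.coeFn_zero ℂ 2 barrier] with p hp
      rw [interaction, map_zero, hp]
      simp
    refine ⟨(integrable_zero _ _ _).congr h.symm, ?_⟩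
    rw [form, integral_congr_ae h]
    simp
  add_mem' := by
    rintro q r ⟨U, hU, hq⟩ ⟨U', hU', hr⟩
    refine ⟨U + U', by simp [hU, hU'], fun V => ?_⟩
    have h : interaction d₁ d₂ α (U + U') V =ᵐ[barrier]
        interaction d₁ d₂ α U V + interaction d₁ d₂ α U' V := by
      filter_upwards [Lp.coeFn_add (trace d₁ d₂ U) (trace d₁ d₂ U')] with p hp
      simp only [interaction, map_add, hp, Pi.add_apply]
      ring
    refine ⟨((hq V).1.add (hr V).1).congr h.symm, ?_⟩
    have e1 := (hq V).2
    have e2 := (hr V).2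
    simp only [form] at e1 e2 ⊢
    rw [integral_congr_ae h, integral_add' (hq V).1 (hr V).1, Prod.snd_add, inner_add_left, ← e1,
      ← e2]
    simp only [Submodule.coe_add, Prod.snd_add, Prod.fst_add, inner_add_left]
    ring
  smul_mem' := by
    rintro c q ⟨U, hU, hq⟩
    refine ⟨c • U, by simp [hU], fun V => ?_⟩
    have h : interaction d₁ d₂ α (c • U) V =ᵐ[barrier]
        fun p => starRingEnd ℂ c * interaction d₁ d₂ α U V p := by
      filter_upwards [Lp.coeFn_smul c (trace d₁ d₂ U)] with p hp
      simp only [interaction, map_smul, hp, Pi.smul_apply, smul_eq_mul, map_mul]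
      ring
    refine ⟨((hq V).1.const_mul _).congr h.symm, ?_⟩
    have e1 := (hq V).2
    simp only [form] at e1 ⊢
    rw [integral_congr_ae h, integral_const_mul, Prod.smul_snd, inner_smul_left, ← e1]
    simp only [Submodule.coe_smul, Prod.smul_snd, Prod.smul_fst, inner_smul_left]
    ring

/-- The Hamiltonian `H_{αm} = -Δ_D^Ω + α(x) δ(y)`, the self-adjoint operator in `L²(Ω)`
associated with the form `E_{αm}`. -/
def hamiltonian (d₁ d₂ : ℝ) (α : ℝ → ℝ) : L2Strip d₁ d₂ →ₗ.[ℂ] L2Strip d₁ d₂ :=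
  (hamiltonianGraph d₁ d₂ α).toLinearPMap

/-- The set `ℂ⁺_{Ω,α₀}`: all `k` with `Im k > 0` or `k² ∈ [0, inf σ(H_{α₀m}))`. -/
def upperSet (d₁ d₂ α₀ : ℝ) : Set ℂ :=
  {k | 0 < k.im ∨ ∃ t : ℝ, k ^ 2 = t ∧ 0 ≤ t ∧
    (t : EReal) < infSpectrum (hamiltonian d₁ d₂ fun _ => α₀)}

/-! ### Resolvents and their traces -/

/-- `R^k(α) = (H_{αm} - k²)⁻¹`. -/
def R (d₁ d₂ : ℝ) (α : ℝ → ℝ) (k : ℂ) : L2Strip d₁ d₂ →ₗ.[ℂ] L2Strip d₁ d₂ :=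
  resolvent (hamiltonian d₁ d₂ α) (k ^ 2)

/-- `R^k_{dx,m}(α) = I_m R^k(α) : L²(Ω) → L²(m)`. -/
def RdxM (d₁ d₂ : ℝ) (α : ℝ → ℝ) (k : ℂ) : L2Strip d₁ d₂ →ₗ.[ℂ] L2Barrier :=
  pcomp (tracePMap d₁ d₂) (R d₁ d₂ α k)

/-- `R^k_{m,dx}(α) = (R^{k̄}_{dx,m}(α))* : L²(m) → L²(Ω)`. -/
def RMdx (d₁ d₂ : ℝ) (α : ℝ → ℝ) (k : ℂ) : L2Barrier →ₗ.[ℂ] L2Strip d₁ d₂ :=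
  (RdxM d₁ d₂ α (starRingEnd ℂ k)).adjoint

/-- `R^k_{m,m}(α) = I_m R^k_{m,dx}(α) : L²(m) → L²(m)`. -/
def RMM (d₁ d₂ : ℝ) (α : ℝ → ℝ) (k : ℂ) : L2Barrier →ₗ.[ℂ] L2Barrier :=
  pcomp (tracePMap d₁ d₂) (RMdx d₁ d₂ α k)

/-- The operator of multiplication by `w(x)` in `L²(m)`, on its maximal domain. -/
def mulOp (w : ℝ → ℝ) : L2Barrier →ₗ.[ℂ] L2Barrier :=
  Submodule.toLinearPMap
    { carrier := {q : L2Barrier × L2Barrier | q.2 =ᵐ[barrier] fun p => (w p.1 : ℂ) * q.1 p}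
      zero_mem' := by
        filter_upwards [Lp.coeFn_zero ℂ 2 barrier] with p hp
        change (0 : L2Barrier) p = _ * (0 : L2Barrier) p
        rw [hp]
        simp
      add_mem' := by
        rintro q r hq hr
        filter_upwards [hq, hr, Lp.coeFn_add q.1 r.1, Lp.coeFn_add q.2 r.2] with p a b c d
        simp only [Prod.snd_add, Prod.fst_add, c, d, Pi.add_apply, a, b]
        ring
      smul_mem' := by
        rintro c q hq
        filter_upwards [hq, Lp.coeFn_smul c q.1, Lp.coeFn_smul c q.2] with p a b d
        simp only [Prod.smul_snd, Prod.smul_fst, b, d, Pi.smul_apply, a, smul_eq_mul]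
        ring }

/-- Multiplication by `|α - α₀|^{1/2}`. -/
def absSqrt (α : ℝ → ℝ) (α₀ : ℝ) : L2Barrier →ₗ.[ℂ] L2Barrier :=
  mulOp fun x => Real.sqrt |α x - α₀|

/-- Multiplication by `(α - α₀)^{1/2} := |α - α₀|^{1/2} sgn(α - α₀)`. -/
def sgnSqrt (α : ℝ → ℝ) (α₀ : ℝ) : L2Barrier →ₗ.[ℂ] L2Barrier :=
  mulOp fun x => Real.sqrt |α x - α₀| * Real.sign (α x - α₀)

/-- The bracket `I + |α - α₀|^{1/2} R^k_{m,m}(α₀) (α - α₀)^{1/2}`. -/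
def bracket (d₁ d₂ : ℝ) (α : ℝ → ℝ) (α₀ : ℝ) (k : ℂ) : L2Barrier →ₗ.[ℂ] L2Barrier :=
  pid L2Barrier +
    pcomp (absSqrt α α₀) (pcomp (RMM d₁ d₂ (fun _ => α₀) k) (sgnSqrt α α₀))

/-- The Birman-Schwinger term `R^k_{m,dx}(α₀) (α - α₀)^{1/2} [I + ...]⁻¹ |α - α₀|^{1/2}
R^k_{dx,m}(α₀)`, a product of partially defined operators on its natural domain. -/
def birmanSchwingerTerm (d₁ d₂ : ℝ) (α : ℝ → ℝ) (α₀ : ℝ) (k : ℂ) :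
    L2Strip d₁ d₂ →ₗ.[ℂ] L2Strip d₁ d₂ :=
  pcomp (RMdx d₁ d₂ (fun _ => α₀) k)
    (pcomp (sgnSqrt α α₀)
      (pcomp (bracket d₁ d₂ α α₀ k).inverse
        (pcomp (absSqrt α α₀) (RdxM d₁ d₂ (fun _ => α₀) k))))

end Waveguide

end

noncomputable section

namespace Waveguide

/-! ### Graphs of partially defined operators -/

section Graphs

variable {E F G : Type*} [NormedAddCommGroup E] [NormedSpace ℂ E] [NormedAddCommGroup F]
  [NormedSpace ℂ F] [NormedAddCommGroup G] [NormedSpace ℂ G]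

/-! Everything is pulled back to the form domain `V`, that is W₀^{1,2}(Ω) with its Hilbert norm,
where forms become bounded operators. Let j : V → L²(Ω) be the embedding and E the bounded operator
on V representing the form of H. Then H - z corresponds to the pencil E - z j*j: z lies in the
resolvent set iff the pencil is invertible on V (`IsAssociated.mem_resolventSet_iff`), and then (H -
z)⁻¹ = j (E - z j*j)⁻¹ j* (`IsAssociated.resolvent_eq`).

Let T be the trace, P = |α - α₀|^{1/2} T and Q = (α - α₀)^{1/2} T. Both are bounded on V because |α
- α₀| ≤ C (1 + α²), and the two forms differ by Q*P. With A the pencil of α₀, invertible by the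
conditions on k, the operator A + Q*P is invertible iff K = 1 + P A⁻¹ Q* is (`isUnit_add_iff`), and
then (A + Q*P)⁻¹ = A⁻¹ - A⁻¹ Q* K⁻¹ P A⁻¹. Placing this between j and j* gives the formula.

The remaining point is domains. The bracket is only the restriction of K to the dense domain D of (α
- α₀)^{1/2}, which is enough for the equivalence (`hasBoundedInverse_iff_isUnit`). The product is
defined everywhere because the inverse bracket sends P A⁻¹ j*u to P (A + Q*P)⁻¹ j*u, and P maps V
into D: (α - α₀) T is also bounded into L²(m), thanks to the α² in the assumption.

Products and inverses are compared through their graphs. The analytic inputs are `emb_injective`,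
the bounded weighted traces, and the coercivity of both forms, which for constant α₀ rests on
`norm_sq_traceMap_le`. -/

lemma mem_graph_pcomp {g : F →ₗ.[ℂ] G} {f : E →ₗ.[ℂ] F} {x : E} {z : G} :
    (x, z) ∈ (pcomp g f).graph ↔ ∃ y, (x, y) ∈ f.graph ∧ (y, z) ∈ g.graph := by
  constructor
  · rw [LinearPMap.mem_graph_iff]
    rintro ⟨⟨x', hx'⟩, rfl, rfl⟩
    obtain ⟨⟨⟨x', hx'⟩, hg, rfl⟩, hf⟩ := hx'
    exact ⟨f ⟨x', hf⟩, f.mem_graph ⟨x', hf⟩, g.mem_graph ⟨f ⟨x', hf⟩, hg⟩⟩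
  · rintro ⟨y, hf, hg⟩
    rw [LinearPMap.mem_graph_iff] at hf hg
    obtain ⟨⟨x', hx'⟩, h1, h2⟩ := hf
    obtain ⟨⟨y', hy'⟩, h3, h4⟩ := hg
    dsimp only at h1 h2 h3 h4
    subst h1 h3 h4
    subst h2
    rw [LinearPMap.mem_graph_iff]
    exact ⟨⟨x', ⟨⟨x', hx'⟩, hy', rfl⟩, hx'⟩, rfl, rfl⟩

lemma mem_graph_toPMap_top {f : E →ₗ[ℂ] F} {x : E} {y : F} :
    (x, y) ∈ (f.toPMap ⊤).graph ↔ y = f x := by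
  rw [LinearPMap.mem_graph_iff]
  constructor
  · rintro ⟨⟨x', -⟩, rfl, rfl⟩
    rfl
  · rintro rfl
    exact ⟨⟨x, trivial⟩, rfl, rfl⟩

lemma mem_graph_sub_smul_pid {T : E →ₗ.[ℂ] E} {z : ℂ} {x y : E} :
    (x, y) ∈ (T - z • pid E).graph ↔ (x, y + z • x) ∈ T.graph := by
  simp only [LinearPMap.mem_graph_iff]
  constructor
  · rintro ⟨⟨x', hx', h⟩, rfl, rfl⟩
    refine ⟨⟨x', hx'⟩, rfl, ?_⟩
    change _ = T ⟨x', hx'⟩ - z • x' + z • x'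
    simp
  · rintro ⟨⟨x', hx'⟩, rfl, h⟩
    refine ⟨⟨x', hx', trivial⟩, rfl, ?_⟩
    change T ⟨x', hx'⟩ - z • x' = _
    rw [h]
    simp

lemma mem_graph_pid_add {T : E →ₗ.[ℂ] E} {x y : E} :
    (x, y) ∈ (pid E + T).graph ↔ ∃ w, (x, w) ∈ T.graph ∧ y = x + w := by
  simp only [LinearPMap.mem_graph_iff]
  constructor
  · rintro ⟨⟨x', h, hx'⟩, rfl, rfl⟩
    exact ⟨_, ⟨⟨x', hx'⟩, rfl, rfl⟩, rfl⟩
  · rintro ⟨w, ⟨⟨x', hx'⟩, rfl, rfl⟩, rfl⟩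
    exact ⟨⟨x', trivial, hx'⟩, rfl, rfl⟩

/-- The kernel must be trivial for the swapped graph to be single-valued, so that it is the graph of
`LinearPMap.inverse`. -/
lemma mem_graph_inverse {T : E →ₗ.[ℂ] F} (hT : ∀ x, (x, 0) ∈ T.graph → x = 0) {x : E} {y : F} :
    (y, x) ∈ T.inverse.graph ↔ (x, y) ∈ T.graph := by
  have hker : T.toFun.ker = ⊥ := by
    rw [LinearMap.ker_eq_bot']
    rintro m hm
    have := hT m (by
      have h := T.mem_graph m
      rwa [show T m = 0 from hm] at h)
    exact Subtype.ext this
  rw [LinearPMap.inverse_graph hker]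
  simp only [Submodule.mem_map, Prod.exists]
  constructor
  · rintro ⟨a, b, h, e⟩
    simp only [LinearEquiv.coe_coe, LinearEquiv.prodComm_apply, Prod.swap_prod_mk,
      Prod.mk.injEq] at e
    rwa [← e.1, ← e.2]
  · intro h
    exact ⟨x, y, h, rfl⟩

lemma mem_graph_toLinearPMap_iff {g : Submodule ℂ (E × F)} (hg : ∀ y, (0, y) ∈ g → y = 0)
    {x : E} {y : F} : (x, y) ∈ g.toLinearPMap.graph ↔ (x, y) ∈ g := by
  rw [Submodule.toLinearPMap_graph_eq]
  rintro ⟨a, b⟩ h rfl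
  exact hg b h

lemma pmap_ext {f g : E →ₗ.[ℂ] F} (h : ∀ x y, (x, y) ∈ f.graph ↔ (x, y) ∈ g.graph) : f = g :=
  LinearPMap.eq_of_eq_graph (by ext ⟨x, y⟩; exact h x y)

lemma toPMap_top_sub (f g : E →ₗ[ℂ] F) :
    f.toPMap ⊤ - g.toPMap ⊤ = (f - g).toPMap ⊤ := by
  refine LinearPMap.dExt (by simp [LinearPMap.sub_domain]) ?_
  rintro ⟨x, hx⟩ ⟨y, hy⟩ h
  dsimp only at h
  subst h
  rfl

lemma hasBoundedInverse_iff_graph {T : E →ₗ.[ℂ] F} :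
    HasBoundedInverse T ↔ (∃ C : ℝ, ∀ x y, (x, y) ∈ T.graph → ‖x‖ ≤ C * ‖y‖) ∧
      Dense {y | ∃ x, (x, y) ∈ T.graph} := by
  have : Set.range T = {y | ∃ x, (x, y) ∈ T.graph} := by
    ext y; exact LinearPMap.mem_range_iff
  rw [HasBoundedInverse, this]
  refine and_congr_left fun _ => exists_congr fun C => ⟨fun h x y hxy => ?_, fun h x => ?_⟩
  · obtain ⟨x', rfl, rfl⟩ := T.mem_graph_iff.1 hxy
    exact h x'
  · exact h _ _ (T.mem_graph x)

lemma mem_resolventSet_iff {T : E →ₗ.[ℂ] E} {z : ℂ} :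
    z ∈ resolventSet T ↔ (∃ C : ℝ, ∀ x y, (x, y + z • x) ∈ T.graph → ‖x‖ ≤ C * ‖y‖) ∧
      ∀ y, ∃ x, (x, y + z • x) ∈ T.graph := by
  have : Set.range (T - z • pid E) = Set.univ ↔ ∀ y, ∃ x, (x, y + z • x) ∈ T.graph := by
    rw [Set.eq_univ_iff_forall]
    refine forall_congr' fun y => ?_
    rw [LinearPMap.mem_range_iff]
    simp only [mem_graph_sub_smul_pid]
  rw [← this]
  refine and_congr_left fun _ => exists_congr fun C => ⟨fun h x y hxy => ?_, fun h x => ?_⟩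
  · rw [← mem_graph_sub_smul_pid] at hxy
    obtain ⟨x', rfl, rfl⟩ := (LinearPMap.mem_graph_iff _).1 hxy
    exact h x'
  · exact h _ _ (mem_graph_sub_smul_pid.1 (LinearPMap.mem_graph _ x))

lemma mul_apply_inverse {A A' : E →L[ℂ] E} (h : A * A' = 1) (U : E) : A (A' U) = U := by
  exact congrArg (fun B : E →L[ℂ] E => B U) h

/-- An operator that factors through the form domain can be followed by the trace without loss of
domain; injectivity of `j` makes the lift to `V` unique. -/
lemma pcomp_toPMap {V H M G : Type*} [NormedAddCommGroup V] [NormedSpace ℂ V]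
    [NormedAddCommGroup H] [NormedSpace ℂ H] [NormedAddCommGroup M] [NormedSpace ℂ M]
    [NormedAddCommGroup G] [NormedSpace ℂ G]
    {tr : H →ₗ.[ℂ] M} {j : V →L[ℂ] H} {T : V →L[ℂ] M}
    (htr : ∀ x y, (x, y) ∈ tr.graph ↔ ∃ U, j U = x ∧ T U = y) (hj : Function.Injective j)
    (B : G →L[ℂ] V) :
    pcomp tr (((j ∘L B : G →L[ℂ] H) : G →ₗ[ℂ] H).toPMap ⊤) =
      ((T ∘L B : G →L[ℂ] M) : G →ₗ[ℂ] M).toPMap ⊤ := by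
  refine pmap_ext fun x y => ?_
  simp only [mem_graph_pcomp, mem_graph_toPMap_top, htr]
  constructor
  · rintro ⟨_, rfl, U, hU, rfl⟩
    rw [hj hU]
    rfl
  · rintro rfl
    exact ⟨_, rfl, B x, rfl, rfl⟩

/-- `1 + P A⁻¹ Q†` is invertible if and only if `A + Q† P` is. -/
lemma isUnit_add_iff {V M : Type*} [NormedAddCommGroup V] [NormedSpace ℂ V]
    [NormedAddCommGroup M] [NormedSpace ℂ M] {A A' : V →L[ℂ] V} (h1 : A * A' = 1) (h2 : A' * A = 1)
    (P : V →L[ℂ] M) (Q : M →L[ℂ] V) :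
    IsUnit (A + Q ∘L P) ↔ IsUnit (1 + P ∘L A' ∘L Q) := by
  have e1 := mul_apply_inverse h1
  have e2 := mul_apply_inverse h2
  constructor
  · rintro ⟨⟨B, B', b1, b2⟩, rfl : B = _⟩
    have f1 : ∀ U, A (B' U) + Q (P (B' U)) = U := mul_apply_inverse b1
    have f2 : ∀ U, B' (A U + Q (P U)) = U := mul_apply_inverse b2
    -- The inverse of 1 + P A⁻¹ Q is 1 - P (A + QP)⁻¹ Q.
    refine ⟨⟨1 + P ∘L A' ∘L Q, 1 - P ∘L B' ∘L Q, ?_, ?_⟩, rfl⟩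
    · ext g
      change (g - P (B' (Q g))) + P (A' (Q (g - P (B' (Q g))))) = g
      have := congrArg (fun U => P (A' U)) (f1 (Q g))
      simp only [map_add, e2] at this
      simp only [map_sub]
      rw [← this]
      abel
    · ext g
      change (g + P (A' (Q g))) - P (B' (Q (g + P (A' (Q g))))) = g
      have := congrArg P (f2 (A' (Q g)))
      simp only [map_add, e1] at this
      simp only [map_add]
      rw [this, add_sub_cancel_right]
  · rintro ⟨⟨K, K', b1, b2⟩, rfl : K = _⟩
    have f1 : ∀ g, K' g + P (A' (Q (K' g))) = g := mul_apply_inverse b1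
    have f2 : ∀ g, K' (g + P (A' (Q g))) = g := mul_apply_inverse b2
    -- Conversely, the Woodbury formula: (A + QP)⁻¹ = A⁻¹ - A⁻¹ Q K⁻¹ P A⁻¹ with K = 1 + P A⁻¹ Q.
    refine ⟨⟨A + Q ∘L P, A' - A' ∘L Q ∘L K' ∘L P ∘L A', ?_, ?_⟩, rfl⟩
    · ext U
      change A (A' U - A' (Q (K' (P (A' U))))) + Q (P (A' U - A' (Q (K' (P (A' U)))))) = U
      have := congrArg Q (f1 (P (A' U)))
      simp only [map_add] at this
      simp only [map_sub, e1]
      rw [← this]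
      abel
    · ext U
      change A' (A U + Q (P U)) - A' (Q (K' (P (A' (A U + Q (P U)))))) = U
      have := congrArg (fun g => A' (Q g)) (f2 (P U))
      simp only [map_add] at this
      simp only [map_add, e2]
      rw [this, add_sub_cancel_right]

end Graphs

/-! ### Operators associated with bounded forms -/

section Forms

variable {V H M : Type*} [NormedAddCommGroup V] [InnerProductSpace ℂ V] [CompleteSpace V]
  [NormedAddCommGroup H] [InnerProductSpace ℂ H] [CompleteSpace H]
  [NormedAddCommGroup M] [InnerProductSpace ℂ M] [CompleteSpace M]

open ContinuousLinearMap (adjoint)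

/-- The bounded operator on the form domain that represents the form of `T - z`. -/
def pencil (j : V →L[ℂ] H) (E : V →L[ℂ] V) (z : ℂ) : V →L[ℂ] V := E - z • (adjoint j ∘L j)

lemma pencil_apply (j : V →L[ℂ] H) (E : V →L[ℂ] V) (z : ℂ) (U : V) :
    pencil j E z U = E U - z • adjoint j (j U) := rfl

lemma inner_pencil (j : V →L[ℂ] H) (E : V →L[ℂ] V) (z : ℂ) (U : V) :
    ⟪pencil j E z U, U⟫_ℂ = ⟪E U, U⟫_ℂ - starRingEnd ℂ z * (‖j U‖ ^ 2 : ℝ) := by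
  rw [pencil_apply, inner_sub_left, inner_smul_left, ContinuousLinearMap.adjoint_inner_left,
    inner_self_eq_norm_sq_to_K]
  norm_cast

lemma adjoint_pencil (j : V →L[ℂ] H) {E : V →L[ℂ] V} (hE : adjoint E = E) (z : ℂ) :
    adjoint (pencil j E z) = pencil j E (starRingEnd ℂ z) := by
  rw [pencil, map_sub, hE, map_smulₛₗ, ContinuousLinearMap.adjoint_comp,
    ContinuousLinearMap.adjoint_adjoint]
  rfl

/-- `S` is the operator associated with the form `(U, V) ↦ ⟪E U, V⟫` on the form domain `V`. -/
def IsAssociated (j : V →L[ℂ] H) (E : V →L[ℂ] V) (S : H →ₗ.[ℂ] H) : Prop :=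
  ∀ x y, (x, y) ∈ S.graph ↔ ∃ U, j U = x ∧ E U = adjoint j y

lemma IsAssociated.mem_graph_iff {j : V →L[ℂ] H} {E : V →L[ℂ] V} {S : H →ₗ.[ℂ] H}
    (hS : IsAssociated j E S) {z : ℂ} (x y : H) :
    (x, y + z • x) ∈ S.graph ↔ ∃ U, j U = x ∧ pencil j E z U = adjoint j y := by
  rw [hS]
  refine exists_congr fun U => and_congr_right fun h => ?_
  subst h
  rw [pencil_apply, map_add, map_smul, sub_eq_iff_eq_add]

/-- Boundedness from below of the form, modulo the norm of `H`. -/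
def IsCoerciveMod (j : V →L[ℂ] H) (E : V →L[ℂ] V) : Prop :=
  ∃ δ c : ℝ, 0 < δ ∧ ∀ U, δ * ‖U‖ ^ 2 ≤ (⟪E U, U⟫_ℂ).re + c * ‖j U‖ ^ 2

lemma IsCoerciveMod.exists_isUnit {j : V →L[ℂ] H} {E : V →L[ℂ] V} (h : IsCoerciveMod j E) :
    ∃ z, IsUnit (pencil j E z) := by
  obtain ⟨δ, c, hδ, h⟩ := h
  -- At z = -c the pencil is coercive on all of `V`, and Lax–Milgram applies.
  refine ⟨((-c : ℝ) : ℂ), ContinuousLinearMap.isUnit_of_forall_le_norm_inner_map _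
    (c := ⟨δ, hδ.le⟩) hδ fun U => ?_⟩
  refine le_trans ?_ (Complex.re_le_norm _)
  rw [inner_pencil, Complex.conj_ofReal, ← Complex.ofReal_mul, Complex.sub_re, Complex.ofReal_re]
  have := h U
  change ‖U‖ ^ 2 * δ ≤ _
  linarith

/-- Since ⟪E U, U⟫ is real, the imaginary part of ⟪pencil U, U⟫ is Im z ‖j U‖², so the pencil
controls ‖j U‖. Its real part and coercivity modulo `H` then control ‖U‖, and Lax–Milgram applies.
-/
lemma isUnit_pencil_of_im_ne_zero {j : V →L[ℂ] H} {E : V →L[ℂ] V} (h : IsCoerciveMod j E)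
    (hE : adjoint E = E) {z : ℂ} (hz : z.im ≠ 0) : IsUnit (pencil j E z) := by
  obtain ⟨δ, c, hδ, h⟩ := h
  have hz' : 0 < |z.im| := abs_pos.2 hz
  -- Chosen so that δ ‖U‖² ≤ ‖w‖ + (|c| + |Re z|) ‖w‖ / |Im z| = K ‖w‖ for w = ⟪pencil U, U⟫.
  set K : ℝ := 1 + (|c| + |z.re|) / |z.im| with hK
  have hK0 : 0 < K := by positivity
  have key : ∀ U, ‖U‖ ^ 2 * (δ / K) ≤ ‖⟪pencil j E z U, U⟫_ℂ‖ := by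
    intro U
    have him : (⟪E U, U⟫_ℂ).im = 0 := by
      have : starRingEnd ℂ ⟪E U, U⟫_ℂ = ⟪E U, U⟫_ℂ := by
        rw [inner_conj_symm]
        nth_rewrite 2 [← hE]
        rw [ContinuousLinearMap.adjoint_inner_left]
      exact Complex.conj_eq_iff_im.1 this
    set w := ⟪pencil j E z U, U⟫_ℂ with hw
    have h1 : w.re = (⟪E U, U⟫_ℂ).re - z.re * ‖j U‖ ^ 2 := by
      rw [hw, inner_pencil]; simp [-Complex.ofReal_pow]
    have h2 : w.im = z.im * ‖j U‖ ^ 2 := by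
      rw [hw, inner_pencil]; simp [him, -Complex.ofReal_pow]
    have h3 : |z.im| * ‖j U‖ ^ 2 ≤ ‖w‖ := by
      have := Complex.abs_im_le_norm w
      rwa [h2, abs_mul, abs_of_nonneg (sq_nonneg ‖j U‖)] at this
    have h4 := Complex.re_le_norm w
    have h5 : ‖j U‖ ^ 2 ≤ ‖w‖ / |z.im| := by
      rw [le_div_iff₀ hz']; linarith
    have h6 : (c + z.re) * ‖j U‖ ^ 2 ≤ (|c| + |z.re|) * (‖w‖ / |z.im|) := by
      refine (mul_le_mul_of_nonneg_right (add_le_add (le_abs_self c) (le_abs_self z.re))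
        (sq_nonneg _)).trans (mul_le_mul_of_nonneg_left h5 (by positivity))
    have h7 := h U
    rw [mul_div_assoc', div_le_iff₀ hK0]
    have : ‖w‖ * K = ‖w‖ + (|c| + |z.re|) * (‖w‖ / |z.im|) := by rw [hK]; ring
    rw [this]
    linarith
  exact ContinuousLinearMap.isUnit_of_forall_le_norm_inner_map _
    (c := ⟨δ / K, by positivity⟩) (div_pos hδ hK0) key

/-- A point belongs to the resolvent set iff the pencil is invertible on the form domain. -/
lemma IsAssociated.mem_resolventSet_iff {j : V →L[ℂ] H} {E : V →L[ℂ] V} {S : H →ₗ.[ℂ] H}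
    (hS : IsAssociated j E S) (hc : IsCoerciveMod j E) (hj : Function.Injective j) {z : ℂ} :
    z ∈ resolventSet S ↔ IsUnit (pencil j E z) := by
  rw [Waveguide.mem_resolventSet_iff]
  simp only [hS.mem_graph_iff]
  constructor
  · rintro ⟨⟨C, hC⟩, hsurj⟩
    rw [ContinuousLinearMap.isUnit_iff_bijective]
    constructor
    · rw [injective_iff_map_eq_zero]
      intro U hU
      have := hC (j U) 0 ⟨U, rfl, by rw [hU, map_zero]⟩
      rw [norm_zero, mul_zero, norm_le_zero_iff] at this
      exact hj (by rw [this, map_zero])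
    · intro G
      -- The resolvent only solves for right-hand sides in the range of j*. A general `G` is solved
      -- at an invertible point z₀ first; the error (z - z₀) j*j U₁ does lie in that range and is
      -- removed by U₂.
      obtain ⟨z₀, hz₀⟩ := hc.exists_isUnit
      rw [ContinuousLinearMap.isUnit_iff_bijective] at hz₀
      obtain ⟨U₁, hU₁⟩ := hz₀.2 G
      obtain ⟨x, U₂, -, hU₂⟩ := hsurj ((z - z₀) • j U₁)
      refine ⟨U₁ + U₂, ?_⟩
      rw [map_add, hU₂, ← hU₁, map_smul, pencil_apply, pencil_apply, sub_smul]
      abel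
  · rintro ⟨⟨A, A', h1, h2⟩, rfl : A = _⟩
    constructor
    · refine ⟨‖j ∘L A' ∘L adjoint j‖, ?_⟩
      rintro x y ⟨U, rfl, hU⟩
      have : j U = (j ∘L A' ∘L adjoint j) y := by
        simp only [ContinuousLinearMap.comp_apply, ← hU, mul_apply_inverse h2]
      rw [this]
      exact ContinuousLinearMap.le_opNorm _ _
    · intro y
      exact ⟨_, A' (adjoint j y), rfl, mul_apply_inverse h1 _⟩

/-- The resolvent in terms of the inverse of the pencil. -/
lemma IsAssociated.resolvent_eq {j : V →L[ℂ] H} {E : V →L[ℂ] V} {S : H →ₗ.[ℂ] H}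
    (hS : IsAssociated j E S) {z : ℂ} {A' : V →L[ℂ] V}
    (h1 : pencil j E z * A' = 1) (h2 : A' * pencil j E z = 1) :
    resolvent S z = ((j ∘L A' ∘L adjoint j : H →L[ℂ] H) : H →ₗ[ℂ] H).toPMap ⊤ := by
  refine pmap_ext fun y x => ?_
  rw [resolvent, mem_graph_inverse, mem_graph_sub_smul_pid, hS.mem_graph_iff, mem_graph_toPMap_top]
  · constructor
    · rintro ⟨U, rfl, hU⟩
      change _ = j (A' (adjoint j y))
      rw [← hU, mul_apply_inverse h2]
    · rintro rfl
      exact ⟨A' (adjoint j y), rfl, mul_apply_inverse h1 _⟩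
  · intro x hx
    rw [mem_graph_sub_smul_pid, hS.mem_graph_iff] at hx
    obtain ⟨U, rfl, hU⟩ := hx
    rw [← mul_apply_inverse h2 U, hU, map_zero, map_zero, map_zero]

lemma adjoint_toPMap (B : H →L[ℂ] M) :
    ((B : H →ₗ[ℂ] M).toPMap ⊤).adjoint =
      ((adjoint B : M →L[ℂ] H) : M →ₗ[ℂ] H).toPMap ⊤ :=
  ContinuousLinearMap.toPMap_adjoint_eq_adjoint_toPMap_of_dense B (by simp)

/-- The unbounded factors are absorbed: S₁ T is the bounded operator P, and T* S₂ is a restriction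
of the bounded operator Q*. The domain of S₂ is the only restriction that survives. -/
lemma mem_graph_bracket {S₁ S₂ : M →ₗ.[ℂ] M} {T P Q : V →L[ℂ] M}
    (hP : ∀ U, (T U, P U) ∈ S₁.graph)
    (hQ : ∀ f h, (f, h) ∈ S₂.graph → adjoint T h = adjoint Q f) (A' : V →L[ℂ] V) (f g : M) :
    (f, g) ∈ (pid M + pcomp S₁ (pcomp
        (((T ∘L A' ∘L adjoint T : M →L[ℂ] M) : M →ₗ[ℂ] M).toPMap ⊤) S₂)).graph ↔
      f ∈ S₂.domain ∧ g = (1 + P ∘L A' ∘L adjoint Q : M →L[ℂ] M) f := by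
  simp only [mem_graph_pid_add, mem_graph_pcomp, mem_graph_toPMap_top]
  constructor
  · rintro ⟨w, ⟨_, ⟨h, hh, rfl⟩, hw⟩, rfl⟩
    refine ⟨LinearPMap.mem_domain_of_mem_graph hh, ?_⟩
    have : w = P (A' (adjoint T h)) := S₁.mem_graph_snd_inj hw (hP _) rfl
    rw [this, hQ f h hh]
    rfl
  · rintro ⟨hf, rfl⟩
    obtain ⟨h, hh⟩ := LinearPMap.mem_domain_iff.1 hf
    refine ⟨P (A' (adjoint T h)), ⟨_, ⟨h, hh, rfl⟩, hP _⟩, ?_⟩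
    rw [hQ f h hh]
    rfl

/-- A restriction of a bounded operator to a dense domain has a densely defined bounded inverse
if and only if the bounded operator is invertible. -/
lemma hasBoundedInverse_iff_isUnit {B : M →ₗ.[ℂ] M} {D : Submodule ℂ M} {K : M →L[ℂ] M}
    (hD : Dense (D : Set M)) (hB : ∀ f g, (f, g) ∈ B.graph ↔ f ∈ D ∧ g = K f) :
    HasBoundedInverse B ↔ IsUnit K := by
  rw [hasBoundedInverse_iff_graph]
  simp only [hB]
  have hrange : {y | ∃ x, x ∈ D ∧ y = K x} = K '' D := by
    ext y; simp [eq_comm]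
  rw [hrange]
  constructor
  · rintro ⟨⟨C, hC⟩, hd⟩
    rw [ContinuousLinearMap.isUnit_iff_bijective,
      ContinuousLinearMap.bijective_iff_dense_range_and_antilipschitz]
    -- The lower bound passes from the dense domain to all of `M`, so `K` has closed range, which is
    -- also dense.
    have hC' : ∀ f, ‖f‖ ≤ C * ‖K f‖ := fun f =>
      hD.induction (P := fun f => ‖f‖ ≤ C * ‖K f‖) (fun f hf => hC f _ ⟨hf, rfl⟩)
        (isClosed_le continuous_norm (by fun_prop)) f
    refine ⟨?_, ⟨C.toNNReal, ?_⟩⟩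
    · rw [← Submodule.dense_iff_topologicalClosure_eq_top]
      refine hd.mono ?_
      rintro _ ⟨f, -, rfl⟩
      exact ⟨f, rfl⟩
    · refine AddMonoidHomClass.antilipschitz_of_bound K fun f => (hC' f).trans ?_
      gcongr
      exact Real.le_coe_toNNReal C
  · rintro ⟨⟨K, K', b1, b2⟩, rfl⟩
    refine ⟨⟨‖K'‖, ?_⟩, ?_⟩
    · rintro x y ⟨-, rfl⟩
      calc ‖x‖ = ‖K' (K x)‖ := by rw [mul_apply_inverse b2]
        _ ≤ _ := K'.le_opNorm _
    · exact (Function.Surjective.denseRange fun g => ⟨K' g, mul_apply_inverse b1 g⟩).dense_image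
        K.continuous hD

/-- The resolvent formula, together with the characterisation of the resolvent set, for two forms
`E₀` and `E₁ = E₀ + Q† P` on the same domain. -/
theorem birmanSchwinger_abstract {j : V →L[ℂ] H} {E₀ E₁ : V →L[ℂ] V} {S₀ S₁ : H →ₗ.[ℂ] H}
    {tr : H →ₗ.[ℂ] M} {m₁ m₂ : M →ₗ.[ℂ] M} {T P Q : V →L[ℂ] M}
    (hj : Function.Injective j)
    (h₀ : IsAssociated j E₀ S₀) (h₁ : IsAssociated j E₁ S₁) (hc₁ : IsCoerciveMod j E₁)
    (hE₀ : adjoint E₀ = E₀) (hE : E₁ = E₀ + adjoint Q ∘L P)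
    (htr : ∀ x y, (x, y) ∈ tr.graph ↔ ∃ U, j U = x ∧ T U = y)
    (hP : ∀ U, (T U, P U) ∈ m₁.graph)
    (hQ : ∀ f h, (f, h) ∈ m₂.graph → adjoint T h = adjoint Q f)
    (hm₂ : Dense (m₂.domain : Set M)) (hPm : ∀ U, P U ∈ m₂.domain)
    {z : ℂ} (hz : IsUnit (pencil j E₀ z)) :
    let Rx := pcomp tr (resolvent S₀ z)
    let Rm := (pcomp tr (resolvent S₀ (starRingEnd ℂ z))).adjoint
    let B := pid M + pcomp m₁ (pcomp (pcomp tr Rm) m₂)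
    (z ∈ resolventSet S₁ ↔ HasBoundedInverse B) ∧
      (z ∈ resolventSet S₁ → resolvent S₁ z =
        resolvent S₀ z - pcomp Rm (pcomp m₂ (pcomp B.inverse (pcomp m₁ Rx)))) := by
  intro Rx Rm B
  obtain ⟨⟨A, A', a1, a2⟩, hA : A = _⟩ := hz
  have hA1 : pencil j E₀ z * A' = 1 := hA ▸ a1
  have hA2 : A' * pencil j E₀ z = 1 := hA ▸ a2
  have hR₀ := h₀.resolvent_eq hA1 hA2
  have hRx : Rx = ((T ∘L A' ∘L adjoint j : H →L[ℂ] M) : H →ₗ[ℂ] M).toPMap ⊤ := by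
    simp only [Rx]
    rw [hR₀, pcomp_toPMap htr hj]
  have hRm : Rm = ((j ∘L A' ∘L adjoint T : M →L[ℂ] H) : M →ₗ[ℂ] H).toPMap ⊤ := by
    simp only [Rm]
    -- The adjoint of the inverse at z inverts the pencil at the conjugate of z; hence the conjugate
    -- in `Rm` cancels when the adjoint is taken.
    have b1 : pencil j E₀ (starRingEnd ℂ z) * adjoint A' = 1 := by
      rw [← adjoint_pencil j hE₀]
      change adjoint _ ∘L adjoint _ = _
      rw [← ContinuousLinearMap.adjoint_comp]
      change adjoint (A' * pencil j E₀ z) = 1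
      rw [hA2]
      exact ContinuousLinearMap.adjoint_id
    have b2 : adjoint A' * pencil j E₀ (starRingEnd ℂ z) = 1 := by
      rw [← adjoint_pencil j hE₀]
      change adjoint _ ∘L adjoint _ = _
      rw [← ContinuousLinearMap.adjoint_comp]
      change adjoint (pencil j E₀ z * A') = 1
      rw [hA1]
      exact ContinuousLinearMap.adjoint_id
    rw [h₀.resolvent_eq b1 b2, pcomp_toPMap htr hj, adjoint_toPMap]
    simp only [ContinuousLinearMap.adjoint_comp, ContinuousLinearMap.adjoint_adjoint]
    rfl
  have hB : ∀ f g, (f, g) ∈ B.graph ↔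
      f ∈ m₂.domain ∧ g = (1 + P ∘L A' ∘L adjoint Q : M →L[ℂ] M) f := by
    intro f g
    simp only [B]
    rw [hRm, pcomp_toPMap htr hj]
    exact mem_graph_bracket hP hQ A' f g
  have hpen : pencil j E₁ z = A + adjoint Q ∘L P := by
    rw [hA, hE]; simp only [pencil]; abel
  have hu := isUnit_add_iff a1 a2 P (adjoint Q)
  refine ⟨?_, fun hz₁ => ?_⟩
  · rw [h₁.mem_resolventSet_iff hc₁ hj, hpen, hu, hasBoundedInverse_iff_isUnit hm₂ hB]
  · rw [h₁.mem_resolventSet_iff hc₁ hj] at hz₁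
    have hK := hpen ▸ hz₁
    rw [hu] at hK
    obtain ⟨⟨C, C', c1, c2⟩, hC : C = _⟩ := hz₁
    have hC1 : pencil j E₁ z * C' = 1 := hC ▸ c1
    have hC2 : C' * pencil j E₁ z = 1 := hC ▸ c2
    have hCC : ∀ U, A (C' U) + adjoint Q (P (C' U)) = U := fun U => by
      have := mul_apply_inverse hC1 U
      rwa [hpen] at this
    -- The second resolvent identity on the form domain, with A' and C' the inverses of the pencils
    -- of E₀ and E₁.
    have hCA : ∀ U, C' U = A' U - A' (adjoint Q (P (C' U))) := fun U => by
      have := congrArg A' (hCC U)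
      rw [map_add, mul_apply_inverse a2] at this
      rw [← this]; abel
    have hinj := (ContinuousLinearMap.isUnit_iff_bijective.1 hK).1
    have hBinv : ∀ f g, (g, f) ∈ B.inverse.graph ↔
        f ∈ m₂.domain ∧ g = (1 + P ∘L A' ∘L adjoint Q : M →L[ℂ] M) f := by
      intro f g
      rw [mem_graph_inverse, hB]
      intro x hx
      rw [hB] at hx
      exact hinj (by rw [← hx.2, map_zero])
    have hterm : pcomp Rm (pcomp m₂ (pcomp B.inverse (pcomp m₁ Rx))) =
        ((j ∘L A' ∘L adjoint Q ∘L P ∘L C' ∘L adjoint j : H →L[ℂ] H) : H →ₗ[ℂ] H).toPMap ⊤ := by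
      refine pmap_ext fun u v => ?_
      rw [hRx, hRm]
      simp only [mem_graph_pcomp, mem_graph_toPMap_top, hBinv]
      -- P A⁻¹ = K P (A + Q*P)⁻¹. This names the preimage under the bracket; by `hPm` it lies in the
      -- domain of `m₂`, so the whole product is defined at every `u`.
      have hg : P (A' (adjoint j u)) =
          (1 + P ∘L A' ∘L adjoint Q : M →L[ℂ] M) (P (C' (adjoint j u))) := by
        change _ = P (C' (adjoint j u)) + P (A' (adjoint Q (P (C' (adjoint j u)))))
        rw [← map_add]
        congr 1
        nth_rewrite 1 [hCA]
        abel
      constructor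
      · rintro ⟨h, ⟨f, ⟨g, ⟨_, rfl, h1⟩, h2, h3⟩, h4⟩, rfl⟩
        have h5 : g = P (A' (adjoint j u)) := m₁.mem_graph_snd_inj h1 (hP _) rfl
        have h6 : f = P (C' (adjoint j u)) := hinj (by rw [← h3, h5, hg])
        change j (A' (adjoint T h)) = j (A' (adjoint Q (P (C' (adjoint j u)))))
        rw [hQ f h h4, h6]
      · rintro rfl
        obtain ⟨h, hh⟩ := LinearPMap.mem_domain_iff.1 (hPm (C' (adjoint j u)))
        refine ⟨h, ⟨_, ⟨_, ⟨_, rfl, hP _⟩, hPm (C' (adjoint j u)), hg⟩, hh⟩, ?_⟩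
        change _ = j (A' (adjoint T h))
        rw [hQ _ h hh]
        rfl
    rw [hterm, hR₀, h₁.resolvent_eq hC1 hC2, toPMap_top_sub]
    congr 1
    ext u
    change j (C' (adjoint j u)) = j (A' (adjoint j u)) - j (A' (adjoint Q (P (C' (adjoint j u)))))
    rw [← map_sub, ← hCA]

/-- The operator on the form domain that represents the gradient form perturbed by the form
`(U, V) ↦ ⟪B U, T V⟫`. -/
def gradForm (gX gY : V →L[ℂ] H) (T B : V →L[ℂ] M) : V →L[ℂ] V :=
  adjoint gX ∘L gX + adjoint gY ∘L gY + adjoint T ∘L B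

lemma inner_gradForm (gX gY : V →L[ℂ] H) (T B : V →L[ℂ] M) (U V' : V) :
    ⟪gradForm gX gY T B U, V'⟫_ℂ = ⟪gX U, gX V'⟫_ℂ + ⟪gY U, gY V'⟫_ℂ + ⟪B U, T V'⟫_ℂ := by
  change ⟪adjoint gX (gX U) + adjoint gY (gY U) + adjoint T (B U), V'⟫_ℂ = _
  simp only [inner_add_left, ContinuousLinearMap.adjoint_inner_left]

lemma adjoint_gradForm {gX gY : V →L[ℂ] H} {T B : V →L[ℂ] M}
    (hB : ∀ U V, ⟪B U, T V⟫_ℂ = ⟪T U, B V⟫_ℂ) :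
    adjoint (gradForm gX gY T B) = gradForm gX gY T B := by
  refine ContinuousLinearMap.ext fun U => ext_inner_right ℂ fun V => ?_
  rw [ContinuousLinearMap.adjoint_inner_left, ← inner_conj_symm, inner_gradForm, inner_gradForm,
    map_add, map_add, inner_conj_symm, inner_conj_symm, inner_conj_symm, hB]

/-- Coercivity of a form that is a relatively bounded perturbation of the gradient form. -/
lemma isCoerciveMod_gradForm {j gX gY : V →L[ℂ] H} {T B : V →L[ℂ] M}
    (hnorm : ∀ U, ‖U‖ ^ 2 = ‖j U‖ ^ 2 + (‖gX U‖ ^ 2 + ‖gY U‖ ^ 2)) {θ c : ℝ} (hθ : θ < 1)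
    (h : ∀ U, ‖B U‖ * ‖T U‖ ≤ θ * (‖gX U‖ ^ 2 + ‖gY U‖ ^ 2) + c * ‖j U‖ ^ 2) :
    IsCoerciveMod j (gradForm gX gY T B) := by
  -- The form retains 1 - θ of the gradient term; adding 1 - θ to c supplies the same multiple of ‖j
  -- U‖², completing (1 - θ) ‖U‖².
  refine ⟨1 - θ, c + 1 - θ, by linarith, fun U => ?_⟩
  have h1 := (Complex.abs_re_le_norm _).trans (norm_inner_le_norm (𝕜 := ℂ) (B U) (T U))
  have h2 := neg_le_of_abs_le h1
  have h3 : (⟪gX U, gX U⟫_ℂ).re = ‖gX U‖ ^ 2 := (norm_sq_eq_re_inner (𝕜 := ℂ) (gX U)).symm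
  have h4 : (⟪gY U, gY U⟫_ℂ).re = ‖gY U‖ ^ 2 := (norm_sq_eq_re_inner (𝕜 := ℂ) (gY U)).symm
  rw [inner_gradForm, Complex.add_re, Complex.add_re, h3, h4, hnorm]
  have := h U
  linarith

lemma isAssociated_gradForm {j gX gY : V →L[ℂ] H} {T B : V →L[ℂ] M} {S : H →ₗ.[ℂ] H}
    (hS : ∀ x y, (x, y) ∈ S.graph ↔ ∃ U, j U = x ∧
      ∀ V, ⟪gX U, gX V⟫_ℂ + ⟪gY U, gY V⟫_ℂ + ⟪B U, T V⟫_ℂ = ⟪y, j V⟫_ℂ) :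
    IsAssociated j (gradForm gX gY T B) S := by
  intro x y
  rw [hS]
  refine exists_congr fun U => and_congr_right fun _ => ?_
  simp only [← inner_gradForm, ← ContinuousLinearMap.adjoint_inner_left j]
  exact ⟨ext_inner_right ℂ, fun h V => by rw [h]⟩

/-- The resolvent formula for two perturbations of the gradient form. -/
theorem birmanSchwinger_gradForm {j gX gY : V →L[ℂ] H} {T B₀ B₁ P Q : V →L[ℂ] M}
    {S₀ S₁ : H →ₗ.[ℂ] H} {tr : H →ₗ.[ℂ] M} {m₁ m₂ : M →ₗ.[ℂ] M}
    (hnorm : ∀ U, ‖U‖ ^ 2 = ‖j U‖ ^ 2 + (‖gX U‖ ^ 2 + ‖gY U‖ ^ 2)) (hj : Function.Injective j)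
    (hS₀ : ∀ x y, (x, y) ∈ S₀.graph ↔ ∃ U, j U = x ∧
      ∀ V, ⟪gX U, gX V⟫_ℂ + ⟪gY U, gY V⟫_ℂ + ⟪B₀ U, T V⟫_ℂ = ⟪y, j V⟫_ℂ)
    (hS₁ : ∀ x y, (x, y) ∈ S₁.graph ↔ ∃ U, j U = x ∧
      ∀ V, ⟪gX U, gX V⟫_ℂ + ⟪gY U, gY V⟫_ℂ + ⟪B₁ U, T V⟫_ℂ = ⟪y, j V⟫_ℂ)
    (hB₀ : ∀ U V, ⟪B₀ U, T V⟫_ℂ = ⟪T U, B₀ V⟫_ℂ)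
    (hB₁ : ∀ U V, ⟪B₁ U, T V⟫_ℂ = ⟪B₀ U, T V⟫_ℂ + ⟪P U, Q V⟫_ℂ)
    {θ₀ c₀ θ₁ c₁ : ℝ} (hθ₀ : θ₀ < 1) (hθ₁ : θ₁ < 1)
    (hc₀ : ∀ U, ‖B₀ U‖ * ‖T U‖ ≤ θ₀ * (‖gX U‖ ^ 2 + ‖gY U‖ ^ 2) + c₀ * ‖j U‖ ^ 2)
    (hc₁ : ∀ U, ‖B₁ U‖ * ‖T U‖ ≤ θ₁ * (‖gX U‖ ^ 2 + ‖gY U‖ ^ 2) + c₁ * ‖j U‖ ^ 2)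
    (htr : ∀ x y, (x, y) ∈ tr.graph ↔ ∃ U, j U = x ∧ T U = y)
    (hP : ∀ U, (T U, P U) ∈ m₁.graph)
    (hQ : ∀ f h, (f, h) ∈ m₂.graph → ∀ U, ⟪h, T U⟫_ℂ = ⟪f, Q U⟫_ℂ)
    (hm₂ : Dense (m₂.domain : Set M)) (hPm : ∀ U, P U ∈ m₂.domain)
    {z : ℂ} (hz : z.im ≠ 0 ∨ z ∈ resolventSet S₀) :
    let Rx := pcomp tr (resolvent S₀ z)
    let Rm := (pcomp tr (resolvent S₀ (starRingEnd ℂ z))).adjoint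
    let B := pid M + pcomp m₁ (pcomp (pcomp tr Rm) m₂)
    (z ∈ resolventSet S₁ ↔ HasBoundedInverse B) ∧
      (z ∈ resolventSet S₁ → resolvent S₁ z =
        resolvent S₀ z - pcomp Rm (pcomp m₂ (pcomp B.inverse (pcomp m₁ Rx)))) := by
  have hco₀ := isCoerciveMod_gradForm hnorm hθ₀ hc₀
  have has₀ := isAssociated_gradForm hS₀
  have hsa := adjoint_gradForm (gX := gX) (gY := gY) hB₀
  refine birmanSchwinger_abstract (Q := Q) hj has₀ (isAssociated_gradForm hS₁)
    (isCoerciveMod_gradForm hnorm hθ₁ hc₁) hsa ?_ htr hP ?_ hm₂ hPm ?_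
  · refine ContinuousLinearMap.ext fun U => ext_inner_right ℂ fun V => ?_
    change _ = ⟪gradForm gX gY T B₀ U + adjoint Q (P U), V⟫_ℂ
    rw [inner_add_left, inner_gradForm, inner_gradForm, hB₁,
      ContinuousLinearMap.adjoint_inner_left, ← add_assoc]
  · intro f h hfh
    refine ext_inner_right ℂ fun V => ?_
    rw [ContinuousLinearMap.adjoint_inner_left, ContinuousLinearMap.adjoint_inner_left,
      hQ f h hfh]
  · obtain hz | hz := hz
    · exact isUnit_pencil_of_im_ne_zero hco₀ hsa hz
    · exact (has₀.mem_resolventSet_iff hco₀ hj).1 hz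

end Forms

end Waveguide

end

noncomputable section

namespace Waveguide

/-! ### Test functions -/

section Tests

instance (d₁ d₂ : ℝ) : IsFiniteMeasureOnCompacts (stripMeasure d₁ d₂) :=
  inferInstanceAs (IsFiniteMeasureOnCompacts (volume.restrict _))

instance (d₁ d₂ : ℝ) : IsLocallyFiniteMeasure (stripMeasure d₁ d₂) :=
  inferInstanceAs (IsLocallyFiniteMeasure (volume.restrict _))

variable {d₁ d₂ : ℝ}

lemma isOpen_strip (d₁ d₂ : ℝ) : IsOpen (strip d₁ d₂) :=
  (isOpen_lt continuous_const continuous_snd).inter (isOpen_lt continuous_snd continuous_const)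

lemma norm_sq_eq_integral {X : Type*} [MeasurableSpace X] {μ : Measure X} (f : Lp ℂ 2 μ) :
    ‖f‖ ^ 2 = ∫ p, ‖f p‖ ^ 2 ∂μ := by
  have h := inner_self_eq_norm_sq_to_K (𝕜 := ℂ) f
  rw [L2.inner_def] at h
  simp only [inner_self_eq_norm_sq_to_K] at h
  have h2 : ∫ p, ((‖f p‖ : ℂ)) ^ 2 ∂μ = ((∫ p, ‖f p‖ ^ 2 ∂μ : ℝ) : ℂ) := by
    rw [← integral_complex_ofReal]
    simp
  exact Complex.ofReal_injective ((Complex.ofReal_pow _ _).trans (h.symm.trans h2))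

lemma norm_sq_toLp {X : Type*} [MeasurableSpace X] {μ : Measure X} {f : X → ℂ}
    (hf : MemLp f 2 μ) : ‖hf.toLp f‖ ^ 2 = ∫ p, ‖f p‖ ^ 2 ∂μ := by
  rw [norm_sq_eq_integral]
  refine integral_congr_ae ?_
  filter_upwards [hf.coeFn_toLp] with p hp
  rw [hp]

lemma IsTest.continuous {φ : ℝ × ℝ → ℂ} (h : IsTest d₁ d₂ φ) : Continuous φ := h.1.continuous

lemma IsTest.differentiable {φ : ℝ × ℝ → ℂ} (h : IsTest d₁ d₂ φ) : Differentiable ℝ φ :=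
  h.1.differentiable (by simp)

lemma IsTest.continuous_fderiv_apply {φ : ℝ × ℝ → ℂ} (h : IsTest d₁ d₂ φ) (v : ℝ × ℝ) :
    Continuous fun p => fderiv ℝ φ p v :=
  (h.1.continuous_fderiv (by simp)).clm_apply continuous_const

lemma IsTest.hasCompactSupport_fderiv_apply {φ : ℝ × ℝ → ℂ} (h : IsTest d₁ d₂ φ) (v : ℝ × ℝ) :
    HasCompactSupport fun p => fderiv ℝ φ p v :=
  h.2.1.fderiv_apply ℝ v

lemma IsTest.eq_zero {φ : ℝ × ℝ → ℂ} (h : IsTest d₁ d₂ φ) {p : ℝ × ℝ} (hp : p ∉ strip d₁ d₂) :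
    φ p = 0 :=
  image_eq_zero_of_notMem_tsupport fun h' => hp (h.2.2 h')

lemma IsTest.fderiv_eq_zero {φ : ℝ × ℝ → ℂ} (h : IsTest d₁ d₂ φ) {p : ℝ × ℝ}
    (hp : p ∉ strip d₁ d₂) : fderiv ℝ φ p = 0 :=
  image_eq_zero_of_notMem_tsupport fun h' => hp (h.2.2 (tsupport_fderiv_subset ℝ h'))

lemma IsTest.memLp {φ : ℝ × ℝ → ℂ} (h : IsTest d₁ d₂ φ) : MemLp φ 2 (stripMeasure d₁ d₂) :=
  h.continuous.memLp_of_hasCompactSupport h.2.1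

lemma IsTest.memLp_dX {φ : ℝ × ℝ → ℂ} (h : IsTest d₁ d₂ φ) :
    MemLp (dX φ) 2 (stripMeasure d₁ d₂) :=
  (h.continuous_fderiv_apply _).memLp_of_hasCompactSupport (h.hasCompactSupport_fderiv_apply _)

lemma IsTest.memLp_dY {φ : ℝ × ℝ → ℂ} (h : IsTest d₁ d₂ φ) :
    MemLp (dY φ) 2 (stripMeasure d₁ d₂) :=
  (h.continuous_fderiv_apply _).memLp_of_hasCompactSupport (h.hasCompactSupport_fderiv_apply _)

lemma IsTest.ofReal {g : ℝ × ℝ → ℝ} (h1 : ContDiff ℝ ∞ g) (h2 : HasCompactSupport g)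
    (h3 : tsupport g ⊆ strip d₁ d₂) : IsTest d₁ d₂ fun p => (g p : ℂ) := by
  refine ⟨Complex.ofRealCLM.contDiff.comp h1, h2.comp_left (g := fun t : ℝ => (t : ℂ)) (by simp),
    (closure_mono ?_).trans h3⟩
  exact Function.support_comp_subset (g := fun t : ℝ => (t : ℂ)) (by simp) g

lemma dX_add {φ ψ : ℝ × ℝ → ℂ} (hφ : IsTest d₁ d₂ φ) (hψ : IsTest d₁ d₂ ψ) :
    dX (φ + ψ) = dX φ + dX ψ := by
  ext p
  simp [dX, fderiv_add (hφ.differentiable p) (hψ.differentiable p)]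

lemma dY_add {φ ψ : ℝ × ℝ → ℂ} (hφ : IsTest d₁ d₂ φ) (hψ : IsTest d₁ d₂ ψ) :
    dY (φ + ψ) = dY φ + dY ψ := by
  ext p
  simp [dY, fderiv_add (hφ.differentiable p) (hψ.differentiable p)]

lemma dX_smul (c : ℂ) {φ : ℝ × ℝ → ℂ} (hφ : IsTest d₁ d₂ φ) : dX (c • φ) = c • dX φ := by
  ext p
  simp [dX, fderiv_const_smul (hφ.differentiable p) c]

lemma dY_smul (c : ℂ) {φ : ℝ × ℝ → ℂ} (hφ : IsTest d₁ d₂ φ) : dY (c • φ) = c • dY φ := by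
  ext p
  simp [dY, fderiv_const_smul (hφ.differentiable p) c]

/-- `C₀^∞(Ω)`. -/
def testSpace (d₁ d₂ : ℝ) : Submodule ℂ (ℝ × ℝ → ℂ) where
  carrier := {φ | IsTest d₁ d₂ φ}
  zero_mem' := IsTest.zero d₁ d₂
  add_mem' := IsTest.add
  smul_mem' := fun c _ h => h.smul c

end Tests

/-! ### The form domain as a Hilbert space -/

section FormDomain

variable (d₁ d₂ : ℝ)

/-- `L²(Ω)³` with its Hilbert space norm. -/
abbrev Triple : Type := WithLp 2 (L2Strip d₁ d₂ × WithLp 2 (L2Strip d₁ d₂ × L2Strip d₁ d₂))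

/-- `L²(Ω)³` with its Hilbert space norm is `L²(Ω)³` with the maximum norm. -/
def tripleEquiv : Triple d₁ d₂ ≃L[ℂ]
    L2Strip d₁ d₂ × (L2Strip d₁ d₂ × L2Strip d₁ d₂) :=
  (WithLp.prodContinuousLinearEquiv 2 ℂ _ _).trans
    ((ContinuousLinearEquiv.refl ℂ _).prodCongr (WithLp.prodContinuousLinearEquiv 2 ℂ _ _))

/-- The copy `{(φ, ∇φ) : φ ∈ C₀^∞(Ω)}` of the test functions in the Hilbert space `L²(Ω)³`. -/
def tripleTestGraph : Submodule ℂ (Triple d₁ d₂) :=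
  (testGraph d₁ d₂).comap (tripleEquiv d₁ d₂).toLinearEquiv.toLinearMap

/-- `W₀^{1,2}(Ω)` with the Hilbert space norm `(‖u‖² + ‖∇u‖²)^{1/2}`. -/
def FormDomain : Type :=
  ↥(tripleTestGraph d₁ d₂).topologicalClosure

instance : NormedAddCommGroup (FormDomain d₁ d₂) :=
  inferInstanceAs (NormedAddCommGroup ↥(tripleTestGraph d₁ d₂).topologicalClosure)

instance : InnerProductSpace ℂ (FormDomain d₁ d₂) :=
  inferInstanceAs (InnerProductSpace ℂ ↥(tripleTestGraph d₁ d₂).topologicalClosure)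

instance : CompleteSpace (FormDomain d₁ d₂) :=
  inferInstanceAs (CompleteSpace ↥(tripleTestGraph d₁ d₂).topologicalClosure)

/-- The inclusion of the form domain in `L²(Ω)³`. -/
def toTriple : FormDomain d₁ d₂ →L[ℂ] Triple d₁ d₂ :=
  (tripleTestGraph d₁ d₂).topologicalClosure.subtypeL

lemma tripleEquiv_mem (U : FormDomain d₁ d₂) :
    tripleEquiv d₁ d₂ (toTriple d₁ d₂ U) ∈ (testGraph d₁ d₂).topologicalClosure := by
  have h : toTriple d₁ d₂ U ∈ (tripleTestGraph d₁ d₂).topologicalClosure := U.2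
  rw [← SetLike.mem_coe, Submodule.topologicalClosure_coe] at h ⊢
  have h2 := (tripleEquiv d₁ d₂).toHomeomorph.preimage_closure (testGraph d₁ d₂ : Set _)
  exact (h2.symm ▸ h : toTriple d₁ d₂ U ∈ (tripleEquiv d₁ d₂).toHomeomorph ⁻¹' closure _)

/-- The identity from `W₀^{1,2}(Ω)` with the Hilbert space norm. -/
def toW : FormDomain d₁ d₂ →L[ℂ] W d₁ d₂ :=
  ((tripleEquiv d₁ d₂).toContinuousLinearMap ∘L toTriple d₁ d₂).codRestrict _
    (tripleEquiv_mem d₁ d₂)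

lemma symm_mem (U : W d₁ d₂) : (tripleEquiv d₁ d₂).symm U ∈
    (tripleTestGraph d₁ d₂).topologicalClosure := by
  have h := U.2
  rw [← SetLike.mem_coe, Submodule.topologicalClosure_coe] at h ⊢
  have h2 := (tripleEquiv d₁ d₂).toHomeomorph.preimage_closure (testGraph d₁ d₂ : Set _)
  refine Eq.subset h2 ?_
  change tripleEquiv d₁ d₂ ((tripleEquiv d₁ d₂).symm U) ∈ closure (testGraph d₁ d₂ : Set _)
  rwa [ContinuousLinearEquiv.apply_symm_apply]

/-- The identity onto `W₀^{1,2}(Ω)` with the Hilbert space norm. -/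
def ofW : W d₁ d₂ →L[ℂ] FormDomain d₁ d₂ :=
  ((tripleEquiv d₁ d₂).symm.toContinuousLinearMap ∘L Submodule.subtypeL _).codRestrict
    (tripleTestGraph d₁ d₂).topologicalClosure (symm_mem d₁ d₂)

lemma toW_ofW (U : W d₁ d₂) : toW d₁ d₂ (ofW d₁ d₂ U) = U :=
  Subtype.ext ((tripleEquiv d₁ d₂).apply_symm_apply U)

/-- The embedding of the form domain in `L²(Ω)`. -/
def emb : FormDomain d₁ d₂ →L[ℂ] L2Strip d₁ d₂ :=
  ContinuousLinearMap.fst ℂ _ _ ∘L Submodule.subtypeL _ ∘L toW d₁ d₂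

/-- The weak partial derivative in `x`. -/
def gradX : FormDomain d₁ d₂ →L[ℂ] L2Strip d₁ d₂ :=
  ContinuousLinearMap.fst ℂ _ _ ∘L ContinuousLinearMap.snd ℂ _ _ ∘L Submodule.subtypeL _ ∘L
    toW d₁ d₂

/-- The weak partial derivative in `y`. -/
def gradY : FormDomain d₁ d₂ →L[ℂ] L2Strip d₁ d₂ :=
  ContinuousLinearMap.snd ℂ _ _ ∘L ContinuousLinearMap.snd ℂ _ _ ∘L Submodule.subtypeL _ ∘L
    toW d₁ d₂

lemma norm_sq_formDomain (U : FormDomain d₁ d₂) :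
    ‖U‖ ^ 2 = ‖emb d₁ d₂ U‖ ^ 2 + (‖gradX d₁ d₂ U‖ ^ 2 + ‖gradY d₁ d₂ U‖ ^ 2) := by
  change ‖toTriple d₁ d₂ U‖ ^ 2 = _
  rw [WithLp.prod_norm_sq_eq_of_L2, WithLp.prod_norm_sq_eq_of_L2]
  rfl

variable {d₁ d₂} in
/-- A test function as an element of `L²(Ω)³`. -/
def IsTest.triple {φ : ℝ × ℝ → ℂ} (h : IsTest d₁ d₂ φ) :
    L2Strip d₁ d₂ × (L2Strip d₁ d₂ × L2Strip d₁ d₂) :=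
  (h.memLp.toLp φ, (h.memLp_dX.toLp (dX φ), h.memLp_dY.toLp (dY φ)))

variable {d₁ d₂} in
lemma IsTest.represents {φ : ℝ × ℝ → ℂ} (h : IsTest d₁ d₂ φ) : Represents d₁ d₂ φ h.triple :=
  ⟨h.memLp.coeFn_toLp, h.memLp_dX.coeFn_toLp, h.memLp_dY.coeFn_toLp⟩

variable {d₁ d₂} in
lemma Represents.eq_triple {φ : ℝ × ℝ → ℂ} (h : IsTest d₁ d₂ φ) {U} (hU : Represents d₁ d₂ φ U) :
    U = h.triple :=
  Prod.ext (Lp.ext (hU.1.trans h.represents.1.symm)) (Prod.ext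
    (Lp.ext (hU.2.1.trans h.represents.2.1.symm)) (Lp.ext (hU.2.2.trans h.represents.2.2.symm)))

/-- The embedding of `C₀^∞(Ω)` in the form domain. -/
def testEmb : testSpace d₁ d₂ →ₗ[ℂ] FormDomain d₁ d₂ where
  toFun φ := ⟨(tripleEquiv d₁ d₂).symm (IsTest.triple φ.2), Submodule.le_topologicalClosure _ (by
    change tripleEquiv d₁ d₂ ((tripleEquiv d₁ d₂).symm _) ∈ testGraph d₁ d₂
    rw [ContinuousLinearEquiv.apply_symm_apply]
    exact ⟨φ, φ.2, IsTest.represents φ.2⟩)⟩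
  map_add' φ ψ := by
    refine Subtype.ext ?_
    change (tripleEquiv d₁ d₂).symm _ = (tripleEquiv d₁ d₂).symm _ + (tripleEquiv d₁ d₂).symm _
    rw [← map_add]
    congr 1
    have hφ : IsTest d₁ d₂ φ.1 := φ.2
    have hψ : IsTest d₁ d₂ ψ.1 := ψ.2
    have e1 := dX_add hφ hψ
    have e2 := dY_add hφ hψ
    refine Prod.ext ?_ (Prod.ext ?_ ?_)
    · exact MemLp.toLp_add hφ.memLp hψ.memLp
    · exact (MemLp.toLp_congr (hφ.add hψ).memLp_dX (hφ.memLp_dX.add hψ.memLp_dX)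
        (by rw [← e1])).trans
        (MemLp.toLp_add hφ.memLp_dX hψ.memLp_dX)
    · exact (MemLp.toLp_congr (hφ.add hψ).memLp_dY (hφ.memLp_dY.add hψ.memLp_dY)
        (by rw [← e2])).trans
        (MemLp.toLp_add hφ.memLp_dY hψ.memLp_dY)
  map_smul' c φ := by
    refine Subtype.ext ?_
    change (tripleEquiv d₁ d₂).symm _ = c • (tripleEquiv d₁ d₂).symm _
    rw [← map_smul]
    congr 1
    have hφ : IsTest d₁ d₂ φ.1 := φ.2
    have e1 := dX_smul c hφ
    have e2 := dY_smul c hφ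
    refine Prod.ext ?_ (Prod.ext ?_ ?_)
    · exact MemLp.toLp_const_smul c hφ.memLp
    · exact (MemLp.toLp_congr (hφ.smul c).memLp_dX (hφ.memLp_dX.const_smul c) (by rw [← e1])).trans
        (MemLp.toLp_const_smul c hφ.memLp_dX)
    · exact (MemLp.toLp_congr (hφ.smul c).memLp_dY (hφ.memLp_dY.const_smul c) (by rw [← e2])).trans
        (MemLp.toLp_const_smul c hφ.memLp_dY)

lemma toW_testEmb (φ : testSpace d₁ d₂) :
    (toW d₁ d₂ (testEmb d₁ d₂ φ)).1 = IsTest.triple φ.2 :=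
  (tripleEquiv d₁ d₂).apply_symm_apply _

lemma emb_testEmb (φ : testSpace d₁ d₂) :
    emb d₁ d₂ (testEmb d₁ d₂ φ) = (IsTest.memLp φ.2).toLp φ.1 :=
  congrArg Prod.fst (toW_testEmb d₁ d₂ φ)

lemma gradX_testEmb (φ : testSpace d₁ d₂) :
    gradX d₁ d₂ (testEmb d₁ d₂ φ) = (IsTest.memLp_dX φ.2).toLp (dX φ.1) :=
  congrArg (fun q => q.2.1) (toW_testEmb d₁ d₂ φ)

lemma gradY_testEmb (φ : testSpace d₁ d₂) :
    gradY d₁ d₂ (testEmb d₁ d₂ φ) = (IsTest.memLp_dY φ.2).toLp (dY φ.1) :=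
  congrArg (fun q => q.2.2) (toW_testEmb d₁ d₂ φ)

lemma denseRange_testEmb : DenseRange (testEmb d₁ d₂) := by
  have hd := (denseRange_inclusion_iff (Submodule.le_topologicalClosure
    (tripleTestGraph d₁ d₂))).2 subset_rfl
  refine hd.mono ?_
  rintro _ ⟨⟨U, φ, hφ, hU⟩, rfl⟩
  refine ⟨⟨φ, hφ⟩, Subtype.ext ?_⟩
  exact (ContinuousLinearEquiv.symm_apply_eq _).2 (hU.eq_triple hφ).symm

/-- A function in `L²(Ω)` that is orthogonal to all test functions vanishes. -/
lemma eq_zero_of_inner_testEmb (w : L2Strip d₁ d₂)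
    (h : ∀ φ, ⟪emb d₁ d₂ (testEmb d₁ d₂ φ), w⟫_ℂ = 0) : w = 0 := by
  have hloc : LocallyIntegrableOn w (strip d₁ d₂) volume :=
    locallyIntegrableOn_of_locallyIntegrable_restrict
      ((Lp.memLp w).locallyIntegrable (μ := stripMeasure d₁ d₂) (by norm_num))
  -- Fundamental lemma of the calculus of variations; real-valued test functions suffice.
  have := (isOpen_strip d₁ d₂).ae_eq_zero_of_integral_contDiff_smul_eq_zero hloc ?_
  · refine Lp.ext ?_
    refine Filter.EventuallyEq.trans ?_ (Lp.coeFn_zero ℂ 2 _).symm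
    exact (ae_restrict_iff' (isOpen_strip d₁ d₂).measurableSet).2 this
  · intro g h1 h2 h3
    have ht : IsTest d₁ d₂ fun p => (g p : ℂ) := IsTest.ofReal h1 h2 h3
    have := h ⟨_, ht⟩
    rw [emb_testEmb, L2.inner_def] at this
    rw [← this]
    refine (setIntegral_eq_integral_of_forall_compl_eq_zero (s := strip d₁ d₂) ?_).symm.trans ?_
    rotate_left
    · refine integral_congr_ae (μ := stripMeasure d₁ d₂) ?_
      filter_upwards [ht.memLp.coeFn_toLp] with p hp
      rw [hp, RCLike.inner_apply]
      simp [mul_comm]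
    · intro p hp
      have := ht.eq_zero hp
      simp only [Complex.ofReal_eq_zero] at this
      rw [this, zero_smul]

/-- Both integrands vanish off the strip, so this is integration by parts over the whole plane, with
no boundary terms by compact support. -/
lemma integral_conj_fderiv {φ ψ : ℝ × ℝ → ℂ} (hφ : IsTest d₁ d₂ φ) (hψ : IsTest d₁ d₂ ψ)
    (v : ℝ × ℝ) : ∫ p in strip d₁ d₂, starRingEnd ℂ (ψ p) * fderiv ℝ φ p v =
      -∫ p in strip d₁ d₂, starRingEnd ℂ (fderiv ℝ ψ p v) * φ p := by
  rw [setIntegral_eq_integral_of_forall_compl_eq_zero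
      (fun p hp => by rw [hψ.eq_zero hp, map_zero, zero_mul]),
    setIntegral_eq_integral_of_forall_compl_eq_zero
      (fun p hp => by rw [hφ.eq_zero hp, mul_zero])]
  have hint : ∀ {f g : ℝ × ℝ → ℂ}, Continuous f → Continuous g → HasCompactSupport g →
      Integrable (fun p => starRingEnd ℂ (f p) * g p) := fun hf hg hc =>
    (((Complex.continuous_conj.comp hf).mul hg).integrable_of_hasCompactSupport hc.mul_left)
  exact integral_bilinear_fderiv_right_eq_neg_left_of_integrable (μ := volume) (v := v)
    (f := ψ) (g := φ) (B := (ContinuousLinearMap.mul ℝ ℂ).comp (Complex.conjCLE : ℂ →L[ℝ] ℂ))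
    (hint (hψ.continuous_fderiv_apply v) hφ.continuous hφ.2.1)
    (hint hψ.continuous (hφ.continuous_fderiv_apply v) (hφ.hasCompactSupport_fderiv_apply v))
    (hint hψ.continuous hφ.continuous hφ.2.1)
    (fun p _ => hψ.differentiable p) (fun p _ => hφ.differentiable p)

/-- Integration by parts for test functions, extended by density since both sides are continuous in
`U`: the recorded component is a weak derivative. -/
lemma inner_gradX (ψ : testSpace d₁ d₂) (U : FormDomain d₁ d₂) :
    ⟪emb d₁ d₂ (testEmb d₁ d₂ ψ), gradX d₁ d₂ U⟫_ℂ =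
      -⟪gradX d₁ d₂ (testEmb d₁ d₂ ψ), emb d₁ d₂ U⟫_ℂ := by
  refine isClosed_property (p := fun U => ⟪emb d₁ d₂ (testEmb d₁ d₂ ψ), gradX d₁ d₂ U⟫_ℂ =
      -⟪gradX d₁ d₂ (testEmb d₁ d₂ ψ), emb d₁ d₂ U⟫_ℂ) (denseRange_testEmb d₁ d₂)
    (isClosed_eq (by fun_prop) (by fun_prop)) (fun φ => ?_) U
  rw [emb_testEmb, emb_testEmb, gradX_testEmb, gradX_testEmb, L2.inner_def, L2.inner_def]
  have hφ : IsTest d₁ d₂ φ.1 := φ.2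
  have hψ : IsTest d₁ d₂ ψ.1 := ψ.2
  convert integral_conj_fderiv d₁ d₂ hφ hψ (1, 0) using 1
  · refine integral_congr_ae ?_
    filter_upwards [hψ.memLp.coeFn_toLp, hφ.memLp_dX.coeFn_toLp] with p h1 h2
    rw [h1, h2, RCLike.inner_apply, mul_comm]
    rfl
  · congr 1
    refine integral_congr_ae ?_
    filter_upwards [hφ.memLp.coeFn_toLp, hψ.memLp_dX.coeFn_toLp] with p h1 h2
    rw [h1, h2, RCLike.inner_apply, mul_comm]
    rfl

lemma inner_gradY (ψ : testSpace d₁ d₂) (U : FormDomain d₁ d₂) :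
    ⟪emb d₁ d₂ (testEmb d₁ d₂ ψ), gradY d₁ d₂ U⟫_ℂ =
      -⟪gradY d₁ d₂ (testEmb d₁ d₂ ψ), emb d₁ d₂ U⟫_ℂ := by
  refine isClosed_property (p := fun U => ⟪emb d₁ d₂ (testEmb d₁ d₂ ψ), gradY d₁ d₂ U⟫_ℂ =
      -⟪gradY d₁ d₂ (testEmb d₁ d₂ ψ), emb d₁ d₂ U⟫_ℂ) (denseRange_testEmb d₁ d₂)
    (isClosed_eq (by fun_prop) (by fun_prop)) (fun φ => ?_) U
  rw [emb_testEmb, emb_testEmb, gradY_testEmb, gradY_testEmb, L2.inner_def, L2.inner_def]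
  have hφ : IsTest d₁ d₂ φ.1 := φ.2
  have hψ : IsTest d₁ d₂ ψ.1 := ψ.2
  convert integral_conj_fderiv d₁ d₂ hφ hψ (0, 1) using 1
  · refine integral_congr_ae ?_
    filter_upwards [hψ.memLp.coeFn_toLp, hφ.memLp_dY.coeFn_toLp] with p h1 h2
    rw [h1, h2, RCLike.inner_apply, mul_comm]
    rfl
  · congr 1
    refine integral_congr_ae ?_
    filter_upwards [hφ.memLp.coeFn_toLp, hψ.memLp_dY.coeFn_toLp] with p h1 h2
    rw [h1, h2, RCLike.inner_apply, mul_comm]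
    rfl

/-- A weak gradient is determined by its function: if u = 0, its components are orthogonal to all
test functions, hence zero. This makes the operators built from forms and traces single-valued. -/
lemma emb_injective : Function.Injective (emb d₁ d₂) := by
  rw [injective_iff_map_eq_zero]
  intro U hU
  have hx : gradX d₁ d₂ U = 0 := eq_zero_of_inner_testEmb d₁ d₂ _ fun ψ => by
    rw [inner_gradX, hU, inner_zero_right, neg_zero]
  have hy : gradY d₁ d₂ U = 0 := eq_zero_of_inner_testEmb d₁ d₂ _ fun ψ => by
    rw [inner_gradY, hU, inner_zero_right, neg_zero]
  have := norm_sq_formDomain d₁ d₂ U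
  rw [hU, hx, hy] at this
  simpa using this

end FormDomain

end Waveguide

end

noncomputable section

namespace Waveguide

/-! ### Multiplication operators in `L²(m)` -/

section Multiplication

lemma mem_graph_mulOp {w : ℝ → ℝ} {f g : L2Barrier} :
    (f, g) ∈ (mulOp w).graph ↔ g =ᵐ[barrier] fun p => (w p.1 : ℂ) * f p := by
  rw [mulOp, mem_graph_toLinearPMap_iff]
  · rfl
  · intro y hy
    change y =ᵐ[barrier] fun p => (w p.1 : ℂ) * (0 : L2Barrier) p at hy
    refine Lp.ext ?_
    filter_upwards [hy, Lp.coeFn_zero ℂ 2 barrier] with p h1 h2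
    rw [h1, h2]
    simp

/-- L² limits are almost everywhere limits along a subsequence, and a pointwise relation survives
those. A second extraction handles the second component. -/
lemma isClosed_graph_mulOp (w : ℝ → ℝ) :
    IsClosed {q : L2Barrier × L2Barrier | q.2 =ᵐ[barrier] fun p => (w p.1 : ℂ) * q.1 p} := by
  refine IsSeqClosed.isClosed fun u q hu hq => ?_
  have h1 : Filter.Tendsto (fun n => (u n).1) Filter.atTop (nhds q.1) :=
    (continuous_fst.tendsto q).comp hq
  have h2 : Filter.Tendsto (fun n => (u n).2) Filter.atTop (nhds q.2) :=
    (continuous_snd.tendsto q).comp hq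
  obtain ⟨ns, hns, h3⟩ := (tendstoInMeasure_of_tendsto_Lp h1).exists_seq_tendsto_ae
  obtain ⟨ms, hms, h4⟩ := (tendstoInMeasure_of_tendsto_Lp
    (h2.comp hns.tendsto_atTop)).exists_seq_tendsto_ae
  have h5 : ∀ᵐ p ∂barrier, ∀ n, (u n).2 p = (w p.1 : ℂ) * (u n).1 p := ae_all_iff.2 hu
  filter_upwards [h3, h4, h5] with p a b c
  refine tendsto_nhds_unique b ?_
  have := (a.comp hms.tendsto_atTop).const_mul (w p.1 : ℂ)
  refine this.congr fun n => ?_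
  simp [c]

/-- For g orthogonal to the domain, (1 + |w|)⁻¹ g is in the domain, so ∫ |g|² / (1 + |w|) dm = 0 and
g = 0. -/
lemma dense_domain_mulOp {w : ℝ → ℝ} (hw : Measurable w) :
    Dense ((mulOp w).domain : Set L2Barrier) := by
  rw [Submodule.dense_iff_topologicalClosure_eq_top, Submodule.topologicalClosure_eq_top_iff,
    Submodule.eq_bot_iff]
  intro g hg
  rw [Submodule.mem_orthogonal] at hg
  set r : ℝ × ℝ → ℝ := fun p => (1 + |w p.1|)⁻¹ with hr
  have hpos : ∀ p : ℝ × ℝ, 0 < 1 + |w p.1| := fun p => by positivity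
  have hrm : Measurable r := by fun_prop
  have hgm := Lp.aestronglyMeasurable g
  have h1 : MemLp (fun p => (r p : ℂ) * g p) 2 barrier := by
    refine (Lp.memLp g).mono ((by fun_prop : Measurable fun p =>
      (r p : ℂ)).aestronglyMeasurable.mul hgm) (ae_of_all _ fun p => ?_)
    rw [norm_mul, Complex.norm_real, Real.norm_of_nonneg (by positivity)]
    refine mul_le_of_le_one_left (norm_nonneg _) (inv_le_one_of_one_le₀ ?_)
    linarith [abs_nonneg (w p.1)]
  have h2 : MemLp (fun p => (w p.1 : ℂ) * ((r p : ℂ) * g p)) 2 barrier := by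
    refine (Lp.memLp g).mono ((by fun_prop : Measurable fun p : ℝ × ℝ =>
      (w p.1 : ℂ)).aestronglyMeasurable.mul h1.1) (ae_of_all _ fun p => ?_)
    rw [← mul_assoc, norm_mul, norm_mul, Complex.norm_real, Complex.norm_real,
      Real.norm_of_nonneg (by positivity : 0 ≤ r p), Real.norm_eq_abs]
    refine mul_le_of_le_one_left (norm_nonneg _) ?_
    rw [hr, ← div_eq_mul_inv, div_le_one (hpos p)]
    linarith
  have h3 : h1.toLp _ ∈ (mulOp w).domain := by
    refine LinearPMap.mem_domain_of_mem_graph (y := h2.toLp _) (mem_graph_mulOp.2 ?_)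
    filter_upwards [h1.coeFn_toLp, h2.coeFn_toLp] with p a b
    rw [a, b]
  have h4 := hg _ h3
  rw [L2.inner_def] at h4
  have h5 : ∀ᵐ p ∂barrier, ⟪h1.toLp _ p, g p⟫_ℂ = ((r p * ‖g p‖ ^ 2 : ℝ) : ℂ) := by
    filter_upwards [h1.coeFn_toLp] with p a
    rw [a, RCLike.inner_apply, map_mul, mul_left_comm, Complex.mul_conj, Complex.normSq_eq_norm_sq]
    simp
  have h6 : Integrable (fun p => r p * ‖g p‖ ^ 2) barrier :=
    ((L2.integrable_inner (𝕜 := ℂ) (h1.toLp _) g).congr h5).re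
  rw [integral_congr_ae h5, integral_complex_ofReal, Complex.ofReal_eq_zero,
    integral_eq_zero_iff_of_nonneg (fun p => by positivity) h6] at h4
  refine Lp.ext ?_
  filter_upwards [h4, Lp.coeFn_zero ℂ 2 barrier] with p a b
  rw [b]
  have ha : r p * ‖g p‖ ^ 2 = 0 := a
  have : r p ≠ 0 := (inv_pos.2 (hpos p)).ne'
  simpa [this] using ha

end Multiplication

/-! ### Weighted traces -/

section Traces

variable {d₁ d₂ : ℝ}

/-- The inequality in `FormBounded`, with given constants, in terms of the form domain. -/
def FormBound (d₁ d₂ : ℝ) (α : ℝ → ℝ) (a b : ℝ) : Prop :=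
  ∀ φ : testSpace d₁ d₂, Integrable (fun p => ‖φ.1 p‖ ^ 2 * (1 + α p.1 ^ 2)) barrier ∧
    ∫ p, ‖φ.1 p‖ ^ 2 * (1 + α p.1 ^ 2) ∂barrier ≤
      a * (‖gradX d₁ d₂ (testEmb d₁ d₂ φ)‖ ^ 2 + ‖gradY d₁ d₂ (testEmb d₁ d₂ φ)‖ ^ 2) +
        b * ‖emb d₁ d₂ (testEmb d₁ d₂ φ)‖ ^ 2

lemma FormBounded.exists_formBound {α : ℝ → ℝ} (hα : Measurable α)
    (h : FormBounded d₁ d₂ α) : ∃ a b, 0 < a ∧ a < 1 ∧ 0 < b ∧ FormBound d₁ d₂ α a b := by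
  obtain ⟨a, b, ha, ha1, hb, h⟩ := h
  refine ⟨a, b, ha, ha1, hb, fun φ => ?_⟩
  have hφ : IsTest d₁ d₂ φ.1 := φ.2
  have h0 := h φ.1 hφ
  have hm : Measurable fun p : ℝ × ℝ => ‖φ.1 p‖ ^ 2 * (1 + α p.1 ^ 2) := by
    have := hφ.continuous.measurable
    fun_prop
  have hnn : ∀ p : ℝ × ℝ, 0 ≤ ‖φ.1 p‖ ^ 2 * (1 + α p.1 ^ 2) := fun p => by positivity
  have hint : Integrable (fun p => ‖φ.1 p‖ ^ 2 * (1 + α p.1 ^ 2)) barrier := by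
    refine ⟨hm.aestronglyMeasurable, ?_⟩
    rw [hasFiniteIntegral_iff_ofReal (ae_of_all _ hnn)]
    exact h0.trans_lt ENNReal.ofReal_lt_top
  refine ⟨hint, ?_⟩
  rw [← ofReal_integral_eq_lintegral_ofReal hint (ae_of_all _ hnn), integral_add
    ((memLp_two_iff_integrable_sq_norm hφ.memLp_dX.1).1 hφ.memLp_dX)
    ((memLp_two_iff_integrable_sq_norm hφ.memLp_dY.1).1 hφ.memLp_dY), ← norm_sq_toLp hφ.memLp_dX,
    ← norm_sq_toLp hφ.memLp_dY, ← norm_sq_toLp hφ.memLp, ENNReal.ofReal_le_ofReal_iff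
    (by positivity)] at h0
  rw [gradX_testEmb, gradY_testEmb, emb_testEmb]
  exact h0

lemma FormBound.memLp {α w : ℝ → ℝ} {a b C : ℝ} (h : FormBound d₁ d₂ α a b) (hw : Measurable w)
    (hC : ∀ x, w x ^ 2 ≤ C * (1 + α x ^ 2)) (φ : testSpace d₁ d₂) :
    MemLp (fun p => (w p.1 : ℂ) * φ.1 p) 2 barrier := by
  have hφ : IsTest d₁ d₂ φ.1 := φ.2
  have hm : Measurable fun p : ℝ × ℝ => (w p.1 : ℂ) * φ.1 p := by
    have := hφ.continuous.measurable
    fun_prop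
  rw [memLp_two_iff_integrable_sq_norm hm.aestronglyMeasurable]
  refine ((h φ).1.const_mul C).mono' (hm.norm.pow_const 2).aestronglyMeasurable
    (ae_of_all _ fun p => ?_)
  rw [Real.norm_of_nonneg (by positivity), norm_mul, Complex.norm_real, mul_pow, Real.norm_eq_abs,
    sq_abs]
  calc w p.1 ^ 2 * ‖φ.1 p‖ ^ 2 ≤ C * (1 + α p.1 ^ 2) * ‖φ.1 p‖ ^ 2 := by gcongr; exact hC _
    _ = _ := by ring

/-- The bounded operator `U ↦ w · U|_{ℝ × {0}}` exists if `w² ≤ C (1 + α²)`. -/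
lemma FormBound.exists_weightedTrace {α w : ℝ → ℝ} {a b C : ℝ} (h : FormBound d₁ d₂ α a b)
    (ha : 0 < a) (hb : 0 < b) (hw : Measurable w) (hC : ∀ x, w x ^ 2 ≤ C * (1 + α x ^ 2)) :
    ∃ M : FormDomain d₁ d₂ →L[ℂ] L2Barrier, ∀ φ : testSpace d₁ d₂,
      M (testEmb d₁ d₂ φ) =ᵐ[barrier] fun p => (w p.1 : ℂ) * φ.1 p := by
  have hC0 : 0 ≤ C := by
    have h1 : 0 ≤ C * (1 + α 0 ^ 2) := (sq_nonneg _).trans (hC 0)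
    exact nonneg_of_mul_nonneg_left h1 (by positivity)
  let f : testSpace d₁ d₂ →ₗ[ℂ] L2Barrier :=
    { toFun := fun φ => (h.memLp hw hC φ).toLp _
      map_add' := fun φ ψ => (MemLp.toLp_congr _ ((h.memLp hw hC φ).add (h.memLp hw hC ψ))
        (ae_of_all _ fun p => mul_add _ _ _)).trans (MemLp.toLp_add _ _)
      map_smul' := fun c φ => (MemLp.toLp_congr _ ((h.memLp hw hC φ).const_smul c)
        (ae_of_all _ fun p => mul_left_comm _ _ _)).trans (MemLp.toLp_const_smul _ _) }
  -- Both a and b are at most a + b, so the form bound is at most (a + b) ‖U‖²; the factor C comes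
  -- from w² ≤ C (1 + α²).
  have hf : ∀ φ, ‖f φ‖ ≤ Real.sqrt (C * (a + b)) * ‖testEmb d₁ d₂ φ‖ := by
    intro φ
    rw [← Real.sqrt_sq (norm_nonneg (testEmb d₁ d₂ φ)), ← Real.sqrt_mul (by positivity)]
    refine Real.le_sqrt_of_sq_le ?_
    have e : ‖f φ‖ ^ 2 = ∫ p, ‖(w p.1 : ℂ) * φ.1 p‖ ^ 2 ∂barrier :=
      norm_sq_toLp (h.memLp hw hC φ)
    have h1 : ∫ p, ‖(w p.1 : ℂ) * φ.1 p‖ ^ 2 ∂barrier ≤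
        ∫ p, C * (‖φ.1 p‖ ^ 2 * (1 + α p.1 ^ 2)) ∂barrier := by
      refine integral_mono_of_nonneg (ae_of_all _ fun p => by positivity) ((h φ).1.const_mul C)
        (ae_of_all _ fun p => ?_)
      simp only [norm_mul, Complex.norm_real, mul_pow, Real.norm_eq_abs, sq_abs]
      calc w p.1 ^ 2 * ‖φ.1 p‖ ^ 2 ≤ C * (1 + α p.1 ^ 2) * ‖φ.1 p‖ ^ 2 := by gcongr; exact hC _
        _ = _ := by ring
    rw [integral_const_mul] at h1
    have h2 := mul_le_mul_of_nonneg_left (h φ).2 hC0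
    rw [e]
    refine h1.trans (h2.trans ?_)
    rw [mul_assoc]
    refine mul_le_mul_of_nonneg_left ?_ hC0
    rw [norm_sq_formDomain]
    have := mul_nonneg hb.le (add_nonneg (sq_nonneg ‖gradX d₁ d₂ (testEmb d₁ d₂ φ)‖)
      (sq_nonneg ‖gradY d₁ d₂ (testEmb d₁ d₂ φ)‖))
    have := mul_nonneg ha.le (sq_nonneg ‖emb d₁ d₂ (testEmb d₁ d₂ φ)‖)
    linarith
  refine ⟨f.extendOfNorm (testEmb d₁ d₂), fun φ => ?_⟩
  rw [LinearMap.extendOfNorm_eq (denseRange_testEmb d₁ d₂) ⟨_, hf⟩]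
  exact (h.memLp hw hC φ).coeFn_toLp

/-- `I_m` on the form domain. -/
def traceMap (d₁ d₂ : ℝ) : FormDomain d₁ d₂ →L[ℂ] L2Barrier := trace d₁ d₂ ∘L toW d₁ d₂

/-- `trace` defaults to 0 unless a bounded restriction operator exists; the weight w = 1 ≤ 1 + α²
provides one. -/
lemma FormBound.isTrace_trace {α : ℝ → ℝ} {a b : ℝ} (h : FormBound d₁ d₂ α a b)
    (ha : 0 < a) (hb : 0 < b) : IsTrace d₁ d₂ (trace d₁ d₂) := by
  have hex : ∃ T, IsTrace d₁ d₂ T := by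
    obtain ⟨M, hM⟩ := h.exists_weightedTrace ha hb (w := fun _ => 1) (C := 1) measurable_const
      (fun x => by nlinarith [sq_nonneg (α x)])
    refine ⟨M ∘L ofW d₁ d₂, fun U φ hφ hU => ?_⟩
    have : ofW d₁ d₂ U = testEmb d₁ d₂ ⟨φ, hφ⟩ :=
      Subtype.ext (congrArg (tripleEquiv d₁ d₂).symm (hU.eq_triple hφ))
    rw [ContinuousLinearMap.comp_apply, this]
    refine (hM ⟨φ, hφ⟩).trans (ae_of_all _ fun p => ?_)
    simp
  rw [trace, dif_pos hex]
  exact hex.choose_spec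

lemma IsTrace.traceMap_testEmb (h : IsTrace d₁ d₂ (trace d₁ d₂)) (φ : testSpace d₁ d₂) :
    traceMap d₁ d₂ (testEmb d₁ d₂ φ) =ᵐ[barrier] φ.1 := by
  exact h _ φ.1 φ.2 ((congrArg (Represents d₁ d₂ φ.1) (toW_testEmb d₁ d₂ φ)).mpr
    (IsTest.represents φ.2))

/-- `M` is the operator `U ↦ w · I_m U`. -/
def IsWeightedTrace (w : ℝ → ℝ) (M : FormDomain d₁ d₂ →L[ℂ] L2Barrier) : Prop :=
  ∀ U, M U =ᵐ[barrier] fun p => (w p.1 : ℂ) * traceMap d₁ d₂ U p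

/-- The extension by continuity is known only on test functions; closedness of the multiplication
graph carries the pointwise formula to every `U`. -/
lemma FormBound.exists_isWeightedTrace {α w : ℝ → ℝ} {a b C : ℝ} (h : FormBound d₁ d₂ α a b)
    (ha : 0 < a) (hb : 0 < b) (hw : Measurable w) (hC : ∀ x, w x ^ 2 ≤ C * (1 + α x ^ 2)) :
    ∃ M : FormDomain d₁ d₂ →L[ℂ] L2Barrier, IsWeightedTrace w M := by
  obtain ⟨M, hM⟩ := h.exists_weightedTrace ha hb hw hC
  refine ⟨M, fun U => ?_⟩
  refine isClosed_property (p := fun U => (traceMap d₁ d₂ U, M U) ∈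
    {q : L2Barrier × L2Barrier | q.2 =ᵐ[barrier] fun p => (w p.1 : ℂ) * q.1 p})
    (denseRange_testEmb d₁ d₂) ((isClosed_graph_mulOp w).preimage (by fun_prop)) (fun φ => ?_) U
  filter_upwards [hM φ, (h.isTrace_trace ha hb).traceMap_testEmb φ] with p h1 h2
  rw [h1, h2]

/-- The form bound on the whole form domain. -/
lemma FormBound.norm_sq_le {α : ℝ → ℝ} {a b : ℝ} (h : FormBound d₁ d₂ α a b) (ha : 0 < a)
    (hb : 0 < b) {M : FormDomain d₁ d₂ →L[ℂ] L2Barrier} (hM : IsWeightedTrace α M)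
    (U : FormDomain d₁ d₂) :
    ‖traceMap d₁ d₂ U‖ ^ 2 + ‖M U‖ ^ 2 ≤
      a * (‖gradX d₁ d₂ U‖ ^ 2 + ‖gradY d₁ d₂ U‖ ^ 2) + b * ‖emb d₁ d₂ U‖ ^ 2 := by
  refine isClosed_property (p := fun U => ‖traceMap d₁ d₂ U‖ ^ 2 + ‖M U‖ ^ 2 ≤
      a * (‖gradX d₁ d₂ U‖ ^ 2 + ‖gradY d₁ d₂ U‖ ^ 2) + b * ‖emb d₁ d₂ U‖ ^ 2)
    (denseRange_testEmb d₁ d₂) (isClosed_le (by fun_prop) (by fun_prop)) (fun φ => ?_) U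
  refine le_trans (le_of_eq ?_) (h φ).2
  have ht := (h.isTrace_trace ha hb).traceMap_testEmb φ
  have hM' := hM (testEmb d₁ d₂ φ)
  rw [norm_sq_eq_integral, norm_sq_eq_integral, ← integral_add
    ((memLp_two_iff_integrable_sq_norm (Lp.memLp _).1).1 (Lp.memLp _))
    ((memLp_two_iff_integrable_sq_norm (Lp.memLp _).1).1 (Lp.memLp _))]
  refine integral_congr_ae ?_
  filter_upwards [ht, hM'] with p h1 h2
  rw [h2, h1, norm_mul, Complex.norm_real, mul_pow, Real.norm_eq_abs, sq_abs]
  ring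

/-- Pointwise bound behind the trace inequality. -/
lemma IsTest.norm_sq_trace_le {φ : ℝ × ℝ → ℂ} (hφ : IsTest d₁ d₂ φ) {ε : ℝ} (hε : 0 < ε) (x : ℝ) :
    ‖φ (x, 0)‖ ^ 2 ≤ ∫ y, (ε * ‖dY φ (x, y)‖ ^ 2 + ε⁻¹ * ‖φ (x, y)‖ ^ 2) := by
  have hemb : Topology.IsClosedEmbedding fun y : ℝ => (x, y) :=
    
    (Isometry.of_dist_eq fun a b => by simp [Prod.dist_eq]).isClosedEmbedding
  set f : ℝ → ℂ := fun y => φ (x, y) with hf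
  have hfd : ∀ y, HasDerivAt f (dY φ (x, y)) y := fun y =>
    (hφ.differentiable (x, y)).hasFDerivAt.comp_hasDerivAt y
      ((hasDerivAt_const y x).prodMk (hasDerivAt_id y))
  have hfs : ContDiff ℝ 1 f := (hφ.1.of_le (by simp)).comp (contDiff_const.prodMk contDiff_id)
  have hfc : HasCompactSupport f := hφ.2.1.comp_isClosedEmbedding hemb
  have hgs : ContDiff ℝ 1 fun y => ‖f y‖ ^ 2 := hfs.norm_sq ℝ
  have hgc : HasCompactSupport fun y => ‖f y‖ ^ 2 :=
    hfc.comp_left (g := fun t : ℂ => ‖t‖ ^ 2) (by simp)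
  have hd : ∀ y, deriv (fun y => ‖f y‖ ^ 2) y = 2 * ⟪f y, dY φ (x, y)⟫_ℝ := fun y =>
    (hfd y).norm_sq.deriv
  have hcY : Continuous fun y => dY φ (x, y) :=
    (hφ.continuous_fderiv_apply (0, 1)).comp (by fun_prop)
  have hsY : HasCompactSupport fun y => dY φ (x, y) :=
    (hφ.hasCompactSupport_fderiv_apply (0, 1)).comp_isClosedEmbedding hemb
  have hint : Integrable fun y => ε * ‖dY φ (x, y)‖ ^ 2 + ε⁻¹ * ‖f y‖ ^ 2 := by
    refine Integrable.add (Integrable.const_mul ?_ _) (Integrable.const_mul ?_ _)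
    · exact (by fun_prop : Continuous fun y => ‖dY φ (x, y)‖ ^ 2).integrable_of_hasCompactSupport
        (hsY.comp_left (g := fun t : ℂ => ‖t‖ ^ 2) (by simp))
    · exact hgs.continuous.integrable_of_hasCompactSupport hgc
  have hpt : ∀ y, ‖deriv (fun y => ‖f y‖ ^ 2) y‖ ≤ ε * ‖dY φ (x, y)‖ ^ 2 + ε⁻¹ * ‖f y‖ ^ 2 := by
    intro y
    rw [hd, norm_mul, Real.norm_two]
    have h1 := norm_inner_le_norm (𝕜 := ℝ) (f y) (dY φ (x, y))
    -- Young's inequality with weight ε, from expanding a square.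
    have h2 : 0 ≤ ε⁻¹ * (ε * ‖dY φ (x, y)‖ - ‖f y‖) ^ 2 := by positivity
    have h3 : ε⁻¹ * (ε * ‖dY φ (x, y)‖ - ‖f y‖) ^ 2 = ε * ‖dY φ (x, y)‖ ^ 2 + ε⁻¹ * ‖f y‖ ^ 2 -
        2 * (‖f y‖ * ‖dY φ (x, y)‖) := by
      field_simp
      ring
    linarith
  -- By compact support, |φ(x,0)|² is minus the integral of ∂|φ|²/∂y over y > 0.
  have h0 := HasCompactSupport.integral_Ioi_deriv_eq hgs hgc 0
  calc ‖φ (x, 0)‖ ^ 2 = ‖∫ y in Set.Ioi 0, deriv (fun y => ‖f y‖ ^ 2) y‖ := by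
        rw [h0, norm_neg, norm_pow, norm_norm]
    _ ≤ ∫ y in Set.Ioi 0, ‖deriv (fun y => ‖f y‖ ^ 2) y‖ := norm_integral_le_integral_norm _
    _ ≤ ∫ y in Set.Ioi 0, (ε * ‖dY φ (x, y)‖ ^ 2 + ε⁻¹ * ‖f y‖ ^ 2) :=
        integral_mono_of_nonneg (ae_of_all _ fun _ => norm_nonneg _) hint.integrableOn
          (ae_of_all _ hpt)
    _ ≤ _ := setIntegral_le_integral hint (ae_of_all _ fun y => by positivity)

lemma IsTest.integral_trace_le {φ : ℝ × ℝ → ℂ} (hφ : IsTest d₁ d₂ φ) {ε : ℝ} (hε : 0 < ε) :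
    ∫ p, ‖φ p‖ ^ 2 ∂barrier ≤ ε * ∫ p, ‖dY φ p‖ ^ 2 ∂stripMeasure d₁ d₂ +
      ε⁻¹ * ∫ p, ‖φ p‖ ^ 2 ∂stripMeasure d₁ d₂ := by
  have hcY : Continuous (dY φ) := hφ.continuous_fderiv_apply (0, 1)
  have hsY : HasCompactSupport (dY φ) := hφ.hasCompactSupport_fderiv_apply (0, 1)
  have hi1 : Integrable fun p => ‖dY φ p‖ ^ 2 :=
    (memLp_two_iff_integrable_sq_norm hcY.aestronglyMeasurable).1
      (hcY.memLp_of_hasCompactSupport hsY)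
  have hi2 : Integrable fun p => ‖φ p‖ ^ 2 :=
    (memLp_two_iff_integrable_sq_norm hφ.continuous.aestronglyMeasurable).1
      (hφ.continuous.memLp_of_hasCompactSupport hφ.2.1)
  have hi : Integrable (fun p => ε * ‖dY φ p‖ ^ 2 + ε⁻¹ * ‖φ p‖ ^ 2)
      ((volume : Measure ℝ).prod volume) :=
    (hi1.const_mul ε).add (hi2.const_mul ε⁻¹)
  have e1 : ∫ p, ‖dY φ p‖ ^ 2 ∂stripMeasure d₁ d₂ = ∫ p, ‖dY φ p‖ ^ 2 :=
    setIntegral_eq_integral_of_forall_compl_eq_zero fun p hp => by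
      rw [dY, hφ.fderiv_eq_zero hp]
      simp
  have e2 : ∫ p, ‖φ p‖ ^ 2 ∂stripMeasure d₁ d₂ = ∫ p, ‖φ p‖ ^ 2 :=
    setIntegral_eq_integral_of_forall_compl_eq_zero fun p hp => by
      rw [hφ.eq_zero hp]
      simp
  have e3 : ∫ p, ‖φ p‖ ^ 2 ∂barrier = ∫ x, ‖φ (x, 0)‖ ^ 2 :=
    integral_map (by fun_prop) (hφ.continuous.norm.pow 2).aestronglyMeasurable
  have e4 : ∫ p, (ε * ‖dY φ p‖ ^ 2 + ε⁻¹ * ‖φ p‖ ^ 2) =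
      ∫ x, ∫ y, (ε * ‖dY φ (x, y)‖ ^ 2 + ε⁻¹ * ‖φ (x, y)‖ ^ 2) := integral_prod _ hi
  have e5 : ∫ p, (ε * ‖dY φ p‖ ^ 2 + ε⁻¹ * ‖φ p‖ ^ 2) =
      (ε * ∫ p, ‖dY φ p‖ ^ 2) + ε⁻¹ * ∫ p, ‖φ p‖ ^ 2 := by
    rw [integral_add (hi1.const_mul ε) (hi2.const_mul ε⁻¹), integral_const_mul, integral_const_mul]
  rw [e1, e2, e3, ← e5, e4]
  exact integral_mono_of_nonneg (ae_of_all _ fun _ => sq_nonneg _) hi.integral_prod_left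
    (ae_of_all _ fun x => hφ.norm_sq_trace_le hε x)

/-- The trace is infinitesimally bounded with respect to the gradient. -/
lemma norm_sq_traceMap_le (h : IsTrace d₁ d₂ (trace d₁ d₂)) {ε : ℝ} (hε : 0 < ε)
    (U : FormDomain d₁ d₂) :
    ‖traceMap d₁ d₂ U‖ ^ 2 ≤ ε * ‖gradY d₁ d₂ U‖ ^ 2 + ε⁻¹ * ‖emb d₁ d₂ U‖ ^ 2 := by
  refine isClosed_property (p := fun U => ‖traceMap d₁ d₂ U‖ ^ 2 ≤
      ε * ‖gradY d₁ d₂ U‖ ^ 2 + ε⁻¹ * ‖emb d₁ d₂ U‖ ^ 2)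
    (denseRange_testEmb d₁ d₂) (isClosed_le (by fun_prop) (by fun_prop)) (fun φ => ?_) U
  have hφ : IsTest d₁ d₂ φ.1 := φ.2
  have e : ‖traceMap d₁ d₂ (testEmb d₁ d₂ φ)‖ ^ 2 = ∫ p, ‖φ.1 p‖ ^ 2 ∂barrier := by
    rw [norm_sq_eq_integral]
    refine integral_congr_ae ?_
    filter_upwards [h.traceMap_testEmb φ] with p hp
    rw [hp]
  rw [gradY_testEmb, emb_testEmb, norm_sq_toLp, norm_sq_toLp, e]
  exact hφ.integral_trace_le hε

end Traces

end Waveguide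

end

noncomputable section

namespace Waveguide

/-! ### The Hamiltonian as the operator associated with a bounded form -/

section Hamiltonian

variable {d₁ d₂ : ℝ}

/-- The weights multiply, so a form with weight v w factors through two weighted traces; this is how
the difference of the two forms becomes Q*P. -/
lemma inner_weightedTrace {v w : ℝ → ℝ} {M N : FormDomain d₁ d₂ →L[ℂ] L2Barrier}
    (hM : IsWeightedTrace v M) (hN : IsWeightedTrace w N) (U V : FormDomain d₁ d₂) :
    ⟪M U, N V⟫_ℂ = ∫ p, interaction d₁ d₂ (fun x => v x * w x) (toW d₁ d₂ U) (toW d₁ d₂ V) p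
      ∂barrier := by
  rw [L2.inner_def]
  refine integral_congr_ae ?_
  filter_upwards [hM U, hN V] with p h1 h2
  rw [h1, h2, RCLike.inner_apply, interaction]
  simp only [map_mul, Complex.conj_ofReal, Complex.ofReal_mul]
  change _ = (v p.1 * w p.1 : ℂ) * (starRingEnd ℂ (traceMap d₁ d₂ U p) * traceMap d₁ d₂ V p)
  ring

lemma isWeightedTrace_one : IsWeightedTrace (fun _ => 1) (traceMap d₁ d₂) := fun U =>
  ae_of_all _ fun p => by simp

lemma integrable_interaction {w : ℝ → ℝ} {M : FormDomain d₁ d₂ →L[ℂ] L2Barrier}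
    (hM : IsWeightedTrace w M) (U V : FormDomain d₁ d₂) :
    Integrable (interaction d₁ d₂ w (toW d₁ d₂ U) (toW d₁ d₂ V)) barrier := by
  refine (L2.integrable_inner (𝕜 := ℂ) (M U) (traceMap d₁ d₂ V)).congr ?_
  filter_upwards [hM U] with p h1
  rw [h1, RCLike.inner_apply, interaction]
  simp only [map_mul, Complex.conj_ofReal]
  change _ = (w p.1 : ℂ) * (starRingEnd ℂ (traceMap d₁ d₂ U p) * traceMap d₁ d₂ V p)
  ring

lemma form_eq {w : ℝ → ℝ} {M : FormDomain d₁ d₂ →L[ℂ] L2Barrier}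
    (hM : IsWeightedTrace w M) (U V : FormDomain d₁ d₂) :
    form d₁ d₂ w (toW d₁ d₂ U) (toW d₁ d₂ V) =
      ⟪gradX d₁ d₂ U, gradX d₁ d₂ V⟫_ℂ + ⟪gradY d₁ d₂ U, gradY d₁ d₂ V⟫_ℂ +
        ⟪M U, traceMap d₁ d₂ V⟫_ℂ := by
  rw [inner_weightedTrace hM isWeightedTrace_one]
  simp only [mul_one]
  rfl

lemma mem_graph_hamiltonian {w : ℝ → ℝ} {M : FormDomain d₁ d₂ →L[ℂ] L2Barrier}
    (hM : IsWeightedTrace w M) (x y : L2Strip d₁ d₂) :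
    (x, y) ∈ (hamiltonian d₁ d₂ w).graph ↔ ∃ U, emb d₁ d₂ U = x ∧
      ∀ V, ⟪gradX d₁ d₂ U, gradX d₁ d₂ V⟫_ℂ + ⟪gradY d₁ d₂ U, gradY d₁ d₂ V⟫_ℂ +
        ⟪M U, traceMap d₁ d₂ V⟫_ℂ = ⟪y, emb d₁ d₂ V⟫_ℂ := by
  have key : ∀ x y, (x, y) ∈ hamiltonianGraph d₁ d₂ w ↔ ∃ U, emb d₁ d₂ U = x ∧
      ∀ V, ⟪gradX d₁ d₂ U, gradX d₁ d₂ V⟫_ℂ + ⟪gradY d₁ d₂ U, gradY d₁ d₂ V⟫_ℂ +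
        ⟪M U, traceMap d₁ d₂ V⟫_ℂ = ⟪y, emb d₁ d₂ V⟫_ℂ := by
    intro x y
    constructor
    · rintro ⟨U, hU, h⟩
      refine ⟨ofW d₁ d₂ U, ?_, fun V => ?_⟩
      · change W.incl d₁ d₂ (toW d₁ d₂ (ofW d₁ d₂ U)) = x
        rw [toW_ofW]
        exact hU
      · rw [← form_eq hM, toW_ofW, (h (toW d₁ d₂ V)).2]
        rfl
    · rintro ⟨U, hU, h⟩
      refine ⟨toW d₁ d₂ U, hU, fun V => ?_⟩
      rw [← toW_ofW d₁ d₂ V]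
      exact ⟨integrable_interaction hM _ _, (form_eq hM _ _).trans (h _)⟩
  rw [← key, hamiltonian, mem_graph_toLinearPMap_iff]
  -- The graph is single-valued: u = 0 forces U = 0, and then y is orthogonal to all test functions.
  intro y hy
  rw [key] at hy
  obtain ⟨U, hU, h⟩ := hy
  rw [← map_zero (emb d₁ d₂)] at hU
  rw [emb_injective d₁ d₂ hU] at h
  refine eq_zero_of_inner_testEmb d₁ d₂ y fun φ => ?_
  rw [← inner_conj_symm, ← h]
  simp only [map_zero, inner_zero_left, add_zero]

lemma mem_graph_tracePMap (x : L2Strip d₁ d₂) (y : L2Barrier) :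
    (x, y) ∈ (tracePMap d₁ d₂).graph ↔ ∃ U, emb d₁ d₂ U = x ∧ traceMap d₁ d₂ U = y := by
  have key : ∀ x y, (x, y) ∈ LinearMap.range ((W.incl d₁ d₂).prod
      (trace d₁ d₂ : W d₁ d₂ →ₗ[ℂ] L2Barrier)) ↔
      ∃ U, emb d₁ d₂ U = x ∧ traceMap d₁ d₂ U = y := by
    intro x y
    constructor
    · rintro ⟨U, hU⟩
      rw [← toW_ofW d₁ d₂ U] at hU
      exact ⟨ofW d₁ d₂ U, congrArg Prod.fst hU, congrArg Prod.snd hU⟩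
    · rintro ⟨U, rfl, rfl⟩
      exact ⟨toW d₁ d₂ U, rfl⟩
  rw [← key, tracePMap, mem_graph_toLinearPMap_iff]
  intro y hy
  rw [key] at hy
  obtain ⟨U, hU, rfl⟩ := hy
  rw [← map_zero (emb d₁ d₂)] at hU
  rw [emb_injective d₁ d₂ hU, map_zero]

/-- The form of `α` is relatively bounded with bound `a / 2 < 1`. -/
lemma FormBound.norm_mul_norm_le {α : ℝ → ℝ} {a b : ℝ} (h : FormBound d₁ d₂ α a b) (ha : 0 < a)
    (hb : 0 < b) {M : FormDomain d₁ d₂ →L[ℂ] L2Barrier} (hM : IsWeightedTrace α M)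
    (U : FormDomain d₁ d₂) : ‖M U‖ * ‖traceMap d₁ d₂ U‖ ≤
      a / 2 * (‖gradX d₁ d₂ U‖ ^ 2 + ‖gradY d₁ d₂ U‖ ^ 2) + b / 2 * ‖emb d₁ d₂ U‖ ^ 2 := by
  have h1 := h.norm_sq_le ha hb hM U
  have h2 := two_mul_le_add_sq ‖M U‖ ‖traceMap d₁ d₂ U‖
  linarith

/-- The form of a constant is relatively bounded with bound `1 / 2`. -/
lemma norm_mul_norm_le_const (h : IsTrace d₁ d₂ (trace d₁ d₂)) (α₀ : ℝ)
    (U : FormDomain d₁ d₂) : ‖((α₀ : ℂ) • traceMap d₁ d₂) U‖ * ‖traceMap d₁ d₂ U‖ ≤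
      1 / 2 * (‖gradX d₁ d₂ U‖ ^ 2 + ‖gradY d₁ d₂ U‖ ^ 2) +
        |α₀| * (2 * (|α₀| + 1)) * ‖emb d₁ d₂ U‖ ^ 2 := by
  -- With this ε in the trace inequality, |α₀| ε ≤ 1/2; the summand 1 covers α₀ = 0.
  have hε0 : 0 < (2 * (|α₀| + 1))⁻¹ := by positivity
  have hε1 : |α₀| * (2 * (|α₀| + 1))⁻¹ ≤ 1 / 2 := by
    rw [← div_eq_mul_inv, div_le_div_iff₀ (by positivity) (by norm_num)]
    linarith [abs_nonneg α₀]
  have h1 := mul_le_mul_of_nonneg_left (norm_sq_traceMap_le h hε0 U) (abs_nonneg α₀)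
  have h2 := mul_le_mul_of_nonneg_right hε1 (sq_nonneg ‖gradY d₁ d₂ U‖)
  have h3 := sq_nonneg ‖gradX d₁ d₂ U‖
  have h4 : ‖((α₀ : ℂ) • traceMap d₁ d₂) U‖ = |α₀| * ‖traceMap d₁ d₂ U‖ := by
    rw [smul_apply, norm_smul, Complex.norm_real, Real.norm_eq_abs]
  rw [inv_inv] at h1
  rw [h4]
  linarith

lemma isWeightedTrace_const (α₀ : ℝ) :
    IsWeightedTrace (fun _ => α₀) ((α₀ : ℂ) • traceMap d₁ d₂) := fun U =>
  Lp.coeFn_smul (α₀ : ℂ) (traceMap d₁ d₂ U)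

/-- Off the imaginary axis, either Im k > 0 and Im k² = 2 Re k Im k ≠ 0, or k² is real and below the
spectrum. -/
lemma im_sq_ne_zero_or_mem_resolventSet {α₀ : ℝ} {k : ℂ} (hk : k ∈ upperSet d₁ d₂ α₀)
    (hk₀ : k.re = 0 → k ^ 2 ∈ resolventSet (hamiltonian d₁ d₂ fun _ => α₀)) :
    (k ^ 2).im ≠ 0 ∨ k ^ 2 ∈ resolventSet (hamiltonian d₁ d₂ fun _ => α₀) := by
  by_cases hre : k.re = 0
  · exact Or.inr (hk₀ hre)
  obtain him | ⟨t, ht, -, hlt⟩ := hk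
  · left
    have : (k ^ 2).im = 2 * k.re * k.im := by rw [sq, Complex.mul_im]; ring
    rw [this]
    exact mul_ne_zero (mul_ne_zero two_ne_zero hre) him.ne'
  · right
    by_contra hn
    rw [ht] at hn
    refine absurd (sInf_le ?_) (not_le.2 hlt)
    exact ⟨t, hn, rfl⟩

end Hamiltonian

end Waveguide

end

/-! ### The Birman–Schwinger formula on the strip -/

open Waveguide in
theorem theorem3p1 (d₁ d₂ : ℝ) (hd₁ : 0 < d₁) (hd₂ : 0 < d₂)
    (α : ℝ → ℝ) (hα : Measurable α) (hbound : Waveguide.FormBounded d₁ d₂ α) (α₀ : ℝ)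
    (k : ℂ) (hk : k ∈ Waveguide.upperSet d₁ d₂ α₀)
    (hk₀ : k.re = 0 → k ^ 2 ∈ Waveguide.resolventSet (Waveguide.hamiltonian d₁ d₂ fun _ => α₀)) :
    (k ^ 2 ∈ Waveguide.resolventSet (Waveguide.hamiltonian d₁ d₂ α) ↔
      Waveguide.HasBoundedInverse (Waveguide.bracket d₁ d₂ α α₀ k)) ∧
    (k ^ 2 ∈ Waveguide.resolventSet (Waveguide.hamiltonian d₁ d₂ α) →
      Waveguide.R d₁ d₂ α k =
        Waveguide.R d₁ d₂ (fun _ => α₀) k - Waveguide.birmanSchwingerTerm d₁ d₂ α α₀ k) := by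
  obtain ⟨a, b, ha, ha1, hb, h⟩ := hbound.exists_formBound hα
  have hT := h.isTrace_trace ha hb
  have hC1 : ∀ x, |α x - α₀| ≤ (1 + α₀ ^ 2) * (1 + α x ^ 2) := fun x => by
    rw [abs_le]
    constructor <;> nlinarith [sq_nonneg (α x + 1), sq_nonneg (α x - 1), sq_nonneg (α₀ + 1),
      sq_nonneg (α₀ - 1), sq_nonneg (α x * α₀)]
  have hsign : Measurable Real.sign :=
    Measurable.ite measurableSet_Iio measurable_const
      (Measurable.ite measurableSet_Ioi measurable_const measurable_const)
  obtain ⟨M₁, hM₁⟩ := h.exists_isWeightedTrace ha hb (w := α) (C := 1) hα fun x => by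
    linarith [sq_nonneg (α x)]
  -- N = (α - α₀) T is bounded into L²(m) since (α - α₀)² ≤ 2 (1 + α₀²)(1 + α²).
  obtain ⟨N, hN⟩ := h.exists_isWeightedTrace ha hb (w := fun x => α x - α₀)
    (C := 2 * (1 + α₀ ^ 2)) (by fun_prop) fun x => by
      nlinarith [mul_nonneg (sq_nonneg α₀) (sq_nonneg (α x)), sq_nonneg (α x + α₀)]
  obtain ⟨P, hP⟩ := h.exists_isWeightedTrace ha hb (w := fun x => Real.sqrt |α x - α₀|)
    (C := 1 + α₀ ^ 2) (by fun_prop) fun x => by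
      rw [Real.sq_sqrt (abs_nonneg _)]
      exact hC1 x
  have hsq : ∀ x, Real.sign (α x - α₀) ^ 2 ≤ 1 := fun x => by
    obtain h | h | h := Real.sign_apply_eq (α x - α₀) <;> rw [h] <;> norm_num
  have hms : Measurable fun x => Real.sqrt |α x - α₀| * Real.sign (α x - α₀) :=
    (by fun_prop : Measurable fun x => Real.sqrt |α x - α₀|).mul
      (hsign.comp (hα.sub measurable_const))
  obtain ⟨Q, hQ⟩ := h.exists_isWeightedTrace ha hb
    (w := fun x => Real.sqrt |α x - α₀| * Real.sign (α x - α₀)) (C := 1 + α₀ ^ 2) hms fun x => by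
      rw [mul_pow, Real.sq_sqrt (abs_nonneg _)]
      exact (mul_le_of_le_one_right (abs_nonneg _) (hsq x)).trans (hC1 x)
  have hsqrt : ∀ x, Real.sqrt |α x - α₀| * (Real.sqrt |α x - α₀| * Real.sign (α x - α₀)) =
      α x - α₀ := fun x => by
    rw [← mul_assoc, Real.mul_self_sqrt (abs_nonneg _)]
    obtain h | h | h := lt_trichotomy (α x - α₀) 0
    · rw [Real.sign_of_neg h, abs_of_neg h]
      ring
    · rw [h, abs_zero, zero_mul]
    · rw [Real.sign_of_pos h, abs_of_pos h, mul_one]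
  have hB : ∀ U V, ⟪M₁ U, traceMap d₁ d₂ V⟫_ℂ =
      ⟪((α₀ : ℂ) • traceMap d₁ d₂) U, traceMap d₁ d₂ V⟫_ℂ + ⟪P U, Q V⟫_ℂ := fun U V => by
    have e1 : M₁ U = ((α₀ : ℂ) • traceMap d₁ d₂) U + N U := by
      refine Lp.ext ?_
      filter_upwards [isWeightedTrace_const α₀ U, hM₁ U, hN U,
        Lp.coeFn_add (((α₀ : ℂ) • traceMap d₁ d₂) U) (N U)] with p h1 h2 h3 h4
      rw [h4, Pi.add_apply, h1, h2, h3]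
      push_cast
      ring
    have e2 := inner_weightedTrace hN isWeightedTrace_one U V
    simp only [mul_one] at e2
    have e3 := inner_weightedTrace hP hQ U V
    simp only [hsqrt] at e3
    rw [e1, inner_add_left, e2, e3]
  have hB₀ : ∀ U V, ⟪((α₀ : ℂ) • traceMap d₁ d₂) U, traceMap d₁ d₂ V⟫_ℂ =
      ⟪traceMap d₁ d₂ U, ((α₀ : ℂ) • traceMap d₁ d₂) V⟫_ℂ := fun U V => by
    rw [inner_weightedTrace (isWeightedTrace_const α₀) isWeightedTrace_one,
      inner_weightedTrace isWeightedTrace_one (isWeightedTrace_const α₀)]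
    simp only [mul_one, one_mul]
  have hQ' : ∀ f g, (f, g) ∈ (sgnSqrt α α₀).graph → ∀ U, ⟪g, traceMap d₁ d₂ U⟫_ℂ = ⟪f, Q U⟫_ℂ := by
    intro f g hfg U
    rw [L2.inner_def, L2.inner_def]
    refine integral_congr_ae ?_
    filter_upwards [mem_graph_mulOp.1 hfg, hQ U] with p h1 h2
    rw [h1, h2, RCLike.inner_apply, RCLike.inner_apply, map_mul, Complex.conj_ofReal]
    ring
  -- Multiplying P U by (α - α₀)^{1/2} gives N U, which is in L²(m).
  have hPm : ∀ U, P U ∈ (sgnSqrt α α₀).domain := fun U =>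
    LinearPMap.mem_domain_of_mem_graph (y := N U) (mem_graph_mulOp.2 (by
      filter_upwards [hP U, hN U] with p h1 h2
      rw [h1, h2, ← mul_assoc, ← Complex.ofReal_mul, mul_comm (_ * _) (Real.sqrt _), hsqrt]))
  -- `RMdx` is defined through the resolvent at the square of the conjugate of k, which is the
  -- conjugate spectral parameter.
  have hconj : starRingEnd ℂ k ^ 2 = starRingEnd ℂ (k ^ 2) := (map_pow _ _ _).symm
  have main := birmanSchwinger_gradForm (V := FormDomain d₁ d₂) (H := L2Strip d₁ d₂)
    (M := L2Barrier) (norm_sq_formDomain d₁ d₂) (emb_injective d₁ d₂)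
    (mem_graph_hamiltonian (isWeightedTrace_const α₀)) (mem_graph_hamiltonian hM₁) hB₀ hB
    (by norm_num) (by linarith) (norm_mul_norm_le_const hT α₀) (h.norm_mul_norm_le ha hb hM₁)
    mem_graph_tracePMap (m₁ := absSqrt α α₀) (fun U => mem_graph_mulOp.2 (hP U)) hQ'
    (dense_domain_mulOp hms) hPm (im_sq_ne_zero_or_mem_resolventSet hk hk₀)
  rw [← hconj] at main
  exact main
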